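/- All Hilbert spaces are finite-dimensional and $\log$ is to base $2$. For a Hilbert space $\mathcal H$ let $\mathcal S_{\le}(\mathcal H)$ be the set of positive semidefinite operators $\rho$ on $\mathcal H$ with $\operatorname{tr}\rho\le 1$. For positive semidefinite $\rho,\sigma$ let $F(\rho,\sigma)=\|\sqrt\rho\sqrt\sigma\|_1$ with $\|R\|_1=\operatorname{tr}\sqrt{R^\dagger R}$, and for $\rho,\sigma\in\mathcal S_{\le}(\mathcal H)$ let $P(\rho,\sigma)=\sqrt{1-\bar F(\rho,\sigma)^2}$ be the purified distance, where $\bar F(\rho,\sigma)=F(\rho,\sigma)+\sqrt{(1-\operatorname{tr}\rho)(1-\operatorname{tr}\sigma)}$. For $\rho\in\mathcal S_{\le}(\mathcal H_{A}\otimes\mathcal H_B)$ define, with values in $[-\infty,\infty]$ and $\log 0=-\infty$, $$H_{\min}(A|B)_\rho=\sup_{\sigma\in\mathcal S_{\le}(\mathcal H_B)}\sup\{\lambda\in\mathbb R:\rho\le 2^{-\lambda}\,\mathrm{id}_A\otimes\sigma\},\qquad H_{\max}(A|B)_\rho=\sup_{\sigma\in\mathcal S_{\le}(\mathcal H_B)}\log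 F(\rho,\mathrm{id}_A\otimes\sigma)^2,$$ and for $\varepsilon\ge 0$ $$H^{\varepsilon}_{\min}(A|B)_\rho=\sup_{\tilde\rho}H_{\min}(A|B)_{\tilde\rho},\qquad H^{\varepsilon}_{\max}(A|B)_\rho=\inf_{\tilde\rho}H_{\max}(A|B)_{\tilde\rho},$$ where $\tilde\rho$ ranges over all elements of $\mathcal S_{\le}(\mathcal H_A\otimes\mathcal H_B)$ with $P(\tilde\rho,\rho)\le\varepsilon$. Let $f(\varepsilon)=\log\frac{1}{1-\sqrt{1-\varepsilon^2}}$ for $0<\varepsilon\le 1$ and $f(\varepsilon)=0$ for $\varepsilon>1$. **Theorem.** Let $\varepsilon>0$, $\varepsilon',\varepsilon''\ge 0$ and $\rho=\rho_{ABC}\in\mathcal S_{\le}(\mathcal H_A\otimes\mathcal H_B\otimes\mathcal H_C)$ with $\varepsilon''<\sqrt{\operatorname{tr}\rho}$. Then $$H_{\min}^{\varepsilon'}(AB|C)_\rho\le H_{\min}^{\varepsilon+\varepsilon'+2\varepsilon''}(A|BC)_\rho+H_{\max}^{\varepsilon''}(B|C)_\rho+2f(\varepsilon)$$ and $$H_{\max}^{\varepsilon'}(AB|C)_\rho\ge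 H_{\min}^{\varepsilon''}(A|BC)_\rho+H_{\max}^{\varepsilon+\varepsilon'+2\varepsilon''}(B|C)_\rho-2f(\varepsilon),$$ where $H_{\max}^{\cdot}(B|C)_\rho$ is evaluated on the reduced operator $\rho_{BC}=\operatorname{tr}_A\rho_{ABC}$. -/

import Mathlib

/-!
Finite-dimensional Hilbert spaces are coordinatized by an orthonormal basis: a system `A` is a
finite index type `a` (the space `ℂ^a`), operators are complex matrices, and the tensor product of
two systems is indexed by the product type.
-/

namespace SmoothEntropy

noncomputable section

open scoped MatrixOrder ComplexOrder Kronecker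

variable {n a b c : Type*} [Fintype n] [DecidableEq n] [Fintype a] [DecidableEq a]
  [Fintype b] [DecidableEq b] [Fintype c] [DecidableEq c]

/-- Sub-normalized density operators: positive semidefinite of trace at most one. -/
def IsSubnormalized (ρ : Matrix n n ℂ) : Prop :=
  ρ.PosSemidef ∧ ρ.trace.re ≤ 1

/-- The trace norm `tr √(R† R)`. -/
def traceNorm (R : Matrix n n ℂ) : ℝ :=
  (CFC.sqrt (R.conjTranspose * R)).trace.re

/-- The fidelity `‖√ρ √σ‖₁` of positive semidefinite operators. -/
def fidelity (ρ σ : Matrix n n ℂ) : ℝ :=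
  traceNorm (CFC.sqrt ρ * CFC.sqrt σ)

/-- The generalized fidelity of sub-normalized states. -/
def genFidelity (ρ σ : Matrix n n ℂ) : ℝ :=
  fidelity ρ σ + Real.sqrt ((1 - ρ.trace.re) * (1 - σ.trace.re))

/-- The purified distance of sub-normalized states. -/
def purifiedDist (ρ σ : Matrix n n ℂ) : ℝ :=
  Real.sqrt (1 - genFidelity ρ σ ^ 2)

/-- The partial trace over the first tensor factor. -/
def traceFst (ρ : Matrix (a × b) (a × b) ℂ) : Matrix b b ℂ :=
  Matrix.of fun j j' => ∑ i, ρ (i, j) (i, j')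

/-- An operator on `A ⊗ (B ⊗ C)` seen as an operator on `(A ⊗ B) ⊗ C`. -/
def assocLeft (ρ : Matrix (a × b × c) (a × b × c) ℂ) :
    Matrix ((a × b) × c) ((a × b) × c) ℂ :=
  ρ.submatrix (Equiv.prodAssoc a b c) (Equiv.prodAssoc a b c)

/-- `H_min(A|B)_{ρ|σ}`, the supremum in `[-∞, ∞]` of the real `r` with
`ρ ≤ 2^(-r) (1 ⊗ σ)` in the positive semidefinite (Loewner) order. -/
def minEntropyRel (ρ : Matrix (a × b) (a × b) ℂ) (σ : Matrix b b ℂ) : EReal :=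
  ⨆ (r : ℝ) (_ : ρ ≤ ((2 : ℝ) ^ (-r)) • ((1 : Matrix a a ℂ) ⊗ₖ σ)), (r : EReal)

/-- The conditional min-entropy `H_min(A|B)_ρ`; it is `+∞` for `ρ = 0`. -/
def minEntropy (ρ : Matrix (a × b) (a × b) ℂ) : EReal :=
  ⨆ (σ : Matrix b b ℂ) (_ : IsSubnormalized σ), minEntropyRel ρ σ

/-- The binary logarithm on `[0, ∞)` with values in `[-∞, ∞)`, where `log 0 = -∞`. -/
def log2 (x : ℝ) : EReal :=
  if x = 0 then ⊥ else ((Real.logb 2 x : ℝ) : EReal)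

/-- `H_max(A|B)_{ρ|σ} = log F(ρ, 1 ⊗ σ)²`. -/
def maxEntropyRel (ρ : Matrix (a × b) (a × b) ℂ) (σ : Matrix b b ℂ) : EReal :=
  log2 (fidelity ρ ((1 : Matrix a a ℂ) ⊗ₖ σ) ^ 2)

/-- The conditional max-entropy `H_max(A|B)_ρ`; it is `-∞` for `ρ = 0`. -/
def maxEntropy (ρ : Matrix (a × b) (a × b) ℂ) : EReal :=
  ⨆ (σ : Matrix b b ℂ) (_ : IsSubnormalized σ), maxEntropyRel ρ σ

/-- The `ε`-smooth conditional min-entropy `H_min^ε(A|B)_ρ`. -/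
def smoothMinEntropy (ε : ℝ) (ρ : Matrix (a × b) (a × b) ℂ) : EReal :=
  ⨆ (τ : Matrix (a × b) (a × b) ℂ) (_ : IsSubnormalized τ ∧ purifiedDist τ ρ ≤ ε), minEntropy τ

/-- The `ε`-smooth conditional max-entropy `H_max^ε(A|B)_ρ`. -/
def smoothMaxEntropy (ε : ℝ) (ρ : Matrix (a × b) (a × b) ℂ) : EReal :=
  ⨅ (τ : Matrix (a × b) (a × b) ℂ) (_ : IsSubnormalized τ ∧ purifiedDist τ ρ ≤ ε), maxEntropy τ

/-- The error term `f(ε) = log₂ (1 / (1 - √(1 - ε²)))`. For `ε > 1` the real square root is `0`,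
so that `f(ε) = 0`. -/
def errorTerm (ε : ℝ) : ℝ :=
  Real.logb 2 (1 / (1 - Real.sqrt (1 - ε ^ 2)))

end

end SmoothEntropy

/-! Put `κ = 1 - √(1 - ε²) = 2^(-f(ε))` for `ε < 1`. For `ε ≥ 1` the enlarged ball contains the zero
operator and both inequalities degenerate. Otherwise both are proved by applying a test `0 ≤ T ≤ 1`
that loses weight at most `κ` on an operator `ω` supplied by one smoothing. Such a test moves a
purification of `ω` by at most `ε`. The triangle inequality and monotonicity under contractions,
applied to purifications, then give the radius `ε + ε' + 2ε''`: the detour through `ω` is paid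
twice, the smoothing `τ` that is being tested once.

Min-entropy inequality: let `ω` on `BC` satisfy `F(ω, 1 ⊗ σ) ≤ g` for all `σ`. The fidelity `2F(ω,
X)` is approximated from above by `tr ωP + tr XQ` over block matrices `[[P, 1], [1, Q]] ≥ 0`, and
Sion's minimax theorem gives one pair `(P, Q)` good for every `σ`. The test `T = Q (Q + t)⁻¹` loses
little weight because `P ≥ (Q + t)⁻¹`, and `T (1 ⊗ σ) T` has small trace because `t T² ≤ Q`.
Conjugating `τ ≤ s · 1 ⊗ 1 ⊗ σ` by `1 ⊗ T` yields the smoothed operator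
(`exists_test_of_fidelity_le`, `exists_smoothing_le`).

Max-entropy inequality: let `ω ≤ s · 1 ⊗ σ`. The test acts on the systems purifying the `BC`
marginal, namely `A` and the purifying system of `ω`. It has `tr_A T ≤ μ`, which bounds fidelities
after the test by `√μ` times those of `τ` (`exists_test_of_le`, `fidelity_bend_mul_le`,
`exists_smoothing_fidelity_le`).

In both cases one `f(ε)` pays for the weight loss of the test and the other for a regularization. -/

namespace SmoothEntropy

noncomputable section

open scoped MatrixOrder ComplexOrder Kronecker
open Matrix

set_option linter.unusedSectionVars false

/-! ### Contractions, polar decomposition, trace-norm duality and Uhlmann's theorem. -/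

section Basics

variable {m n d e : Type*} [Fintype m] [DecidableEq m] [Fintype n] [DecidableEq n]
  [Fintype d] [DecidableEq d] [Fintype e] [DecidableEq e]

/-- A matrix as a vector of the Hilbert space with the Hilbert–Schmidt inner product. -/
def vec (M : Matrix n d ℂ) : EuclideanSpace ℂ (n × d) :=
  WithLp.toLp 2 fun p => M p.1 p.2

theorem inner_vec (M N : Matrix n d ℂ) : inner ℂ (vec M) (vec N) = (Mᴴ * N).trace := by
  simp only [vec, PiLp.inner_apply, Matrix.trace, Matrix.diag, Matrix.mul_apply,
    Fintype.sum_prod_type, RCLike.inner_apply, Matrix.conjTranspose_apply]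
  rw [Finset.sum_comm]
  refine Finset.sum_congr rfl fun i _ => Finset.sum_congr rfl fun j _ => ?_
  rw [mul_comm]; rfl

theorem norm_vec_sq (M : Matrix n d ℂ) : ‖vec M‖ ^ 2 = (M * Mᴴ).trace.re := by
  rw [Matrix.trace_mul_comm, ← inner_vec, ← inner_self_eq_norm_sq (𝕜 := ℂ)]
  rfl

theorem trace_re_nonneg {A : Matrix n n ℂ} (hA : A.PosSemidef) : 0 ≤ A.trace.re :=
  (Complex.le_def.mp hA.trace_nonneg).1

theorem trace_re_mono {A B : Matrix n n ℂ} (h : (B - A).PosSemidef) :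
    A.trace.re ≤ B.trace.re := by
  have := trace_re_nonneg h
  rw [Matrix.trace_sub, Complex.sub_re] at this
  linarith

theorem trace_mul_re_nonneg {A B : Matrix n n ℂ} (hA : A.PosSemidef) (hB : B.PosSemidef) :
    0 ≤ (A * B).trace.re := by
  have hs := CFC.sqrt_mul_sqrt_self A (Matrix.nonneg_iff_posSemidef.mpr hA)
  have hp : (CFC.sqrt A).PosSemidef := Matrix.nonneg_iff_posSemidef.mp (CFC.sqrt_nonneg A)
  rw [← hs, Matrix.mul_assoc, Matrix.trace_mul_comm]
  have := trace_re_nonneg (hB.mul_mul_conjTranspose_same (CFC.sqrt A))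
  rwa [hp.1.eq] at this

/-- A rectangular matrix of operator norm at most one. -/
def IsContraction (K : Matrix m n ℂ) : Prop := (1 - Kᴴ * K).PosSemidef

/-- Both conditions are Schur complement criteria for positivity of the block matrix `[[Λ, N], [Nᴴ,
1]]`, taken with respect to its two diagonal blocks. -/
theorem schur_le_one {N : Matrix n m ℂ} {Λ : Matrix n n ℂ} (hΛ : Λ.PosDef)
    (h : (Λ - N * Nᴴ).PosSemidef) : (1 - Nᴴ * Λ⁻¹ * N).PosSemidef := by
  have := hΛ.isUnit.invertible
  rw [← Matrix.PosDef.fromBlocks₁₁ N 1 hΛ]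
  have : Invertible (1 : Matrix m m ℂ) := invertibleOne
  rw [Matrix.PosDef.fromBlocks₂₂ Λ N Matrix.PosDef.one]
  simpa using h

theorem IsContraction.conjTranspose {K : Matrix m n ℂ} (hK : IsContraction K) :
    IsContraction Kᴴ := by
  have := schur_le_one (N := Kᴴ) (Λ := 1) Matrix.PosDef.one
    (by simpa [IsContraction] using hK)
  simpa [IsContraction] using this

theorem isContraction_of_mul_conjTranspose {K : Matrix m n ℂ}
    (h : (1 - K * Kᴴ).PosSemidef) : IsContraction K := by
  have : IsContraction Kᴴ := by simpa [IsContraction] using h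
  simpa using this.conjTranspose

theorem IsContraction.mul {K : Matrix m n ℂ} {J : Matrix n d ℂ}
    (hK : IsContraction K) (hJ : IsContraction J) : IsContraction (K * J) := by
  have h := hJ.add (hK.conjTranspose_mul_mul_same J)
  have e : (1 - (K * J)ᴴ * (K * J)) = (1 - Jᴴ * J) + Jᴴ * (1 - Kᴴ * K) * J := by
    simp only [Matrix.conjTranspose_mul, Matrix.mul_sub, Matrix.sub_mul, Matrix.mul_one,
      Matrix.mul_assoc]
    abel
  unfold IsContraction
  rwa [e]

theorem IsContraction.norm_vec_mul_le {K : Matrix n m ℂ} (hK : IsContraction K)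
    (M : Matrix m d ℂ) : ‖vec (K * M)‖ ≤ ‖vec M‖ := by
  refine le_of_sq_le_sq ?_ (norm_nonneg _)
  rw [norm_vec_sq, norm_vec_sq, Matrix.trace_mul_comm, Matrix.trace_mul_comm M]
  apply trace_re_mono
  have := hK.conjTranspose_mul_mul_same M
  convert this using 1
  simp only [Matrix.conjTranspose_mul, Matrix.mul_sub, Matrix.sub_mul, Matrix.mul_one,
      Matrix.mul_assoc]

theorem sqrt_posSemidef (A : Matrix n n ℂ) : (CFC.sqrt A).PosSemidef :=
  Matrix.nonneg_iff_posSemidef.mp (CFC.sqrt_nonneg A)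

theorem sqrt_mul_sqrt {A : Matrix n n ℂ} (hA : A.PosSemidef) :
    CFC.sqrt A * CFC.sqrt A = A :=
  CFC.sqrt_mul_sqrt_self A (Matrix.nonneg_iff_posSemidef.mpr hA)

theorem sqrt_mul_conjTranspose {A : Matrix n n ℂ} (hA : A.PosSemidef) :
    CFC.sqrt A * (CFC.sqrt A)ᴴ = A := by
  rw [(sqrt_posSemidef A).1.eq, sqrt_mul_sqrt hA]

/-- Hölder's inequality for a positive semidefinite matrix and a contraction. -/
theorem norm_trace_mul_le {A C : Matrix n n ℂ} (hA : A.PosSemidef) (hC : IsContraction C) :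
    ‖(A * C).trace‖ ≤ A.trace.re := by
  set S := CFC.sqrt A
  have hS : Sᴴ = S := (sqrt_posSemidef A).1.eq
  have h1 : (A * C).trace = inner ℂ (vec S) (vec (C * S)) := by
    rw [inner_vec, hS, ← sqrt_mul_sqrt hA, Matrix.mul_assoc, Matrix.trace_mul_comm,
      Matrix.mul_assoc]
  have h2 : ‖vec S‖ ^ 2 = A.trace.re := by rw [norm_vec_sq, hS, sqrt_mul_sqrt hA]
  rw [h1, ← h2, sq]
  exact (norm_inner_le_norm _ _).trans
    (mul_le_mul_of_nonneg_left (hC.norm_vec_mul_le S) (norm_nonneg _))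

/-- Polar decomposition with a contraction in place of a partial isometry. -/
theorem exists_polar (M : Matrix n d ℂ) :
    ∃ V : Matrix n d ℂ, IsContraction V ∧ CFC.sqrt (M * Mᴴ) * V = M ∧
      M * Vᴴ = CFC.sqrt (M * Mᴴ) := by
  set ρ := M * Mᴴ with hρ
  have hps : ρ.PosSemidef := Matrix.posSemidef_self_mul_conjTranspose M
  have hn : 0 ≤ ρ := Matrix.nonneg_iff_posSemidef.mpr hps
  have hsa : IsSelfAdjoint ρ := hps.1
  have hc : ∀ f : ℝ → ℝ, ContinuousOn f (spectrum ℝ ρ) := fun f =>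
    Matrix.finite_real_spectrum.continuousOn f
  have hS : CFC.sqrt ρ = cfc Real.sqrt ρ := by
    rw [CFC.sqrt_eq_real_sqrt ρ hn, cfcₙ_eq_cfc (by fun_prop) Real.sqrt_zero]
  -- Since `0⁻¹ = 0`, this functional calculus gives the pseudo-inverse of `√ρ`, so singular `ρ`
  -- needs no separate treatment. The contraction is `ρ^(-1/2) M`.
  set g : ℝ → ℝ := fun x => (Real.sqrt x)⁻¹ with hg
  set G := cfc g ρ with hG
  have hGs : Gᴴ = G := cfc_predicate (p := IsSelfAdjoint) g ρ
  have hid : cfc (fun x : ℝ => x) ρ = ρ := cfc_id' ℝ ρ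
  have hGρ : G * ρ = CFC.sqrt ρ := by
    rw [hS]
    calc G * ρ = G * cfc (fun x : ℝ => x) ρ := by rw [hid]
      _ = cfc Real.sqrt ρ := ?_
    rw [hG, ← cfc_mul g _ ρ (hc _) (hc _)]
    refine cfc_congr fun x hx => ?_
    have hx0 : 0 ≤ x := spectrum_nonneg_of_nonneg hn hx
    simp only [hg]
    rw [mul_comm, ← div_eq_mul_inv, Real.div_sqrt]
  have hρG : ρ * G = CFC.sqrt ρ := by
    have := congrArg Matrix.conjTranspose hGρ
    rwa [Matrix.conjTranspose_mul, hGs, hps.1.eq, (sqrt_posSemidef ρ).1.eq] at this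
  have hSGρ : CFC.sqrt ρ * G * ρ = ρ := by
    rw [Matrix.mul_assoc, hGρ, sqrt_mul_sqrt hps]
  refine ⟨G * M, ?_, ?_, ?_⟩
  · apply isContraction_of_mul_conjTranspose
    have e : (G * M) * (G * M)ᴴ = G * CFC.sqrt ρ := by
      rw [Matrix.conjTranspose_mul, hGs, ← hρG, hρ]; simp only [Matrix.mul_assoc]
    rw [e, hS, ← Matrix.nonneg_iff_posSemidef, hG, ← cfc_mul g _ ρ (hc _) (hc _),
      ← cfc_one ℝ ρ, ← cfc_sub _ _ ρ (hc _) (hc _)]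
    refine cfc_nonneg fun x hx => ?_
    simp only [hg, Pi.one_apply, sub_nonneg]
    exact inv_mul_le_one
  · have h0 : (CFC.sqrt ρ * (G * M) - M) * (CFC.sqrt ρ * (G * M) - M)ᴴ = 0 := by
      have e : CFC.sqrt ρ * (G * M) - M = (CFC.sqrt ρ * G - 1) * M := by
        simp only [Matrix.sub_mul, Matrix.one_mul, Matrix.mul_assoc]
      have e2 : (CFC.sqrt ρ * G - 1) * M * ((CFC.sqrt ρ * G - 1) * M)ᴴ =
          (CFC.sqrt ρ * G * ρ - ρ) * (CFC.sqrt ρ * G - 1)ᴴ := by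
        rw [Matrix.conjTranspose_mul, ← Matrix.mul_assoc, Matrix.mul_assoc _ M, ← hρ,
          Matrix.sub_mul _ _ ρ, Matrix.one_mul]
      rw [e, e2, hSGρ, sub_self, Matrix.zero_mul]
    exact sub_eq_zero.mp (Matrix.self_mul_conjTranspose_eq_zero.mp h0)
  · rw [Matrix.conjTranspose_mul, hGs, ← Matrix.mul_assoc, hρG]

theorem norm_trace_mul_le_traceNorm (R : Matrix n n ℂ) {K : Matrix n n ℂ}
    (hK : IsContraction K) : ‖(R * K).trace‖ ≤ traceNorm R := by
  obtain ⟨V, hV, h1, -⟩ := exists_polar Rᴴ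
  rw [Matrix.conjTranspose_conjTranspose] at h1
  have e : (R * K).trace = (CFC.sqrt (Rᴴ * R) * (K * Vᴴ)).trace := by
    have : R = Vᴴ * CFC.sqrt (Rᴴ * R) := by
      have := congrArg Matrix.conjTranspose h1
      rw [Matrix.conjTranspose_mul, (sqrt_posSemidef _).1.eq,
        Matrix.conjTranspose_conjTranspose] at this
      exact this.symm
    nth_rewrite 1 [this]
    rw [Matrix.mul_assoc, Matrix.trace_mul_comm, Matrix.mul_assoc]
  rw [e]
  exact norm_trace_mul_le (sqrt_posSemidef _) (hK.mul hV.conjTranspose)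

theorem exists_trace_mul_eq_traceNorm (R : Matrix n n ℂ) :
    ∃ K : Matrix n n ℂ, IsContraction K ∧ (R * K).trace = (traceNorm R : ℂ) := by
  obtain ⟨V, hV, -, h2⟩ := exists_polar Rᴴ
  rw [Matrix.conjTranspose_conjTranspose] at h2
  refine ⟨V, hV, ?_⟩
  have h3 : V * R = CFC.sqrt (Rᴴ * R) := by
    have := congrArg Matrix.conjTranspose h2
    rwa [Matrix.conjTranspose_mul, (sqrt_posSemidef _).1.eq,
      Matrix.conjTranspose_conjTranspose, Matrix.conjTranspose_conjTranspose] at this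
  rw [Matrix.trace_mul_comm, h3, traceNorm]
  have := (Complex.le_def.mp (sqrt_posSemidef (Rᴴ * R)).trace_nonneg).2
  exact Complex.ext (by simp) (by simpa using this.symm)

theorem traceNorm_nonneg (R : Matrix n n ℂ) : 0 ≤ traceNorm R :=
  trace_re_nonneg (sqrt_posSemidef _)

theorem fidelity_nonneg (ρ σ : Matrix n n ℂ) : 0 ≤ fidelity ρ σ := traceNorm_nonneg _

/-- The overlap of two purifications, up to a contraction of the purifying systems, is bounded by
the fidelity. -/
theorem norm_trace_le_fidelity (M : Matrix n d ℂ) (S : Matrix n e ℂ) {K : Matrix e d ℂ}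
    (hK : IsContraction K) :
    ‖(Mᴴ * S * K).trace‖ ≤ fidelity (M * Mᴴ) (S * Sᴴ) := by
  obtain ⟨V, hV, hV1, -⟩ := exists_polar M
  obtain ⟨W, hW, hW1, -⟩ := exists_polar S
  have e : (Mᴴ * S * K).trace =
      (CFC.sqrt (M * Mᴴ) * CFC.sqrt (S * Sᴴ) * (W * K * Vᴴ)).trace := by
    have hM : Mᴴ = Vᴴ * CFC.sqrt (M * Mᴴ) := by
      have := congrArg Matrix.conjTranspose hV1
      rw [Matrix.conjTranspose_mul, (sqrt_posSemidef _).1.eq] at this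
      exact this.symm
    calc (Mᴴ * S * K).trace
        = (Vᴴ * CFC.sqrt (M * Mᴴ) * (CFC.sqrt (S * Sᴴ) * W) * K).trace := by rw [hW1, ← hM]
      _ = _ := ?_
    simp only [Matrix.mul_assoc]
    rw [Matrix.trace_mul_comm]
    simp only [Matrix.mul_assoc]
  rw [e]
  exact norm_trace_mul_le_traceNorm _ ((hW.mul hK).mul hV.conjTranspose)

/-- The bound `norm_trace_le_fidelity` is attained: conjugate an optimal contraction for the trace
norm by the two polar factors. -/
theorem exists_trace_eq_fidelity (M : Matrix n d ℂ) (S : Matrix n e ℂ) :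
    ∃ K : Matrix e d ℂ, IsContraction K ∧
      (Mᴴ * S * K).trace = (fidelity (M * Mᴴ) (S * Sᴴ) : ℂ) := by
  obtain ⟨V, hV, -, hV2⟩ := exists_polar M
  obtain ⟨W, hW, -, hW2⟩ := exists_polar S
  obtain ⟨C, hC, hC1⟩ := exists_trace_mul_eq_traceNorm
    (CFC.sqrt (M * Mᴴ) * CFC.sqrt (S * Sᴴ))
  refine ⟨Wᴴ * C * V, (hW.conjTranspose.mul hC).mul hV, ?_⟩
  rw [fidelity, ← hC1]
  have hM : CFC.sqrt (M * Mᴴ) = V * Mᴴ := by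
    have := congrArg Matrix.conjTranspose hV2
    rw [Matrix.conjTranspose_mul, (sqrt_posSemidef _).1.eq,
      Matrix.conjTranspose_conjTranspose] at this
    exact this.symm
  rw [hM, ← hW2]
  simp only [Matrix.mul_assoc]
  rw [Matrix.trace_mul_comm V]
  simp only [Matrix.mul_assoc]

/-- Uhlmann's theorem, with the purification of the second argument fixed. -/
theorem exists_purification {ρ σ : Matrix n n ℂ} (hρ : ρ.PosSemidef) (hσ : σ.PosSemidef) :
    ∃ M : Matrix n (n ⊕ n) ℂ, M * Mᴴ = ρ ∧
      (Mᴴ * Matrix.fromCols (CFC.sqrt σ) 0).trace = (fidelity ρ σ : ℂ) := by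
  obtain ⟨K, hK, h⟩ := exists_trace_eq_fidelity (CFC.sqrt ρ) (CFC.sqrt σ)
  rw [sqrt_mul_conjTranspose hρ, sqrt_mul_conjTranspose hσ] at h
  have hS : (CFC.sqrt ρ)ᴴ = CFC.sqrt ρ := (sqrt_posSemidef ρ).1.eq
  -- The optimal `K` is only a contraction. Its defect `D` completes it, `Kᴴ K + D² = 1`, which
  -- restores `M Mᴴ = ρ`. The extra columns are invisible to the zero block of the purification of
  -- `σ`.
  set D := CFC.sqrt (1 - Kᴴ * K) with hD
  have hDs : Dᴴ = D := (sqrt_posSemidef _).1.eq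
  have hDD : D * D = 1 - Kᴴ * K := sqrt_mul_sqrt hK
  refine ⟨Matrix.fromCols (CFC.sqrt ρ * Kᴴ) (CFC.sqrt ρ * D), ?_, ?_⟩
  · rw [Matrix.conjTranspose_fromCols_eq_fromRows_conjTranspose, Matrix.fromCols_mul_fromRows,
      Matrix.conjTranspose_mul, Matrix.conjTranspose_mul, Matrix.conjTranspose_conjTranspose,
      hDs, hS]
    calc _ = CFC.sqrt ρ * (Kᴴ * K + D * D) * CFC.sqrt ρ := by noncomm_ring
      _ = ρ := by rw [hDD, add_sub_cancel, Matrix.mul_one, sqrt_mul_sqrt hρ]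
  · rw [← h, Matrix.trace_mul_comm,
      Matrix.conjTranspose_fromCols_eq_fromRows_conjTranspose, Matrix.fromCols_mul_fromRows,
      Matrix.zero_mul, add_zero, Matrix.conjTranspose_mul, Matrix.conjTranspose_conjTranspose,
      hS, ← Matrix.mul_assoc, Matrix.trace_mul_comm]
    simp only [Matrix.mul_assoc]

end Basics

/-! ### Purified distance of vectors of norm at most one. -/

section PureDistance

variable {E : Type*} [NormedAddCommGroup E] [InnerProductSpace ℂ E]

/-- The generalized fidelity of two vectors of norm at most one. -/
def pureFidelity (x y : E) : ℝ :=
  ‖(inner ℂ x y : ℂ)‖ + Real.sqrt ((1 - ‖x‖ ^ 2) * (1 - ‖y‖ ^ 2))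

/-- The purified distance of two vectors of norm at most one. -/
def pureDist (x y : E) : ℝ := Real.sqrt (1 - pureFidelity x y ^ 2)

theorem pureFidelity_nonneg (x y : E) : 0 ≤ pureFidelity x y :=
  add_nonneg (norm_nonneg _) (Real.sqrt_nonneg _)

theorem pureFidelity_comm (x y : E) : pureFidelity x y = pureFidelity y x := by
  rw [pureFidelity, pureFidelity, norm_inner_symm, mul_comm]

theorem pureDist_comm (x y : E) : pureDist x y = pureDist y x := by
  rw [pureDist, pureDist, pureFidelity_comm]

theorem norm_sub_smul_sq {u w : E} (hu : ‖u‖ = 1) (hw : ‖w‖ = 1) (c : ℂ) :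
    ‖u - c • w‖ ^ 2 = 1 - ‖(inner ℂ u w : ℂ)‖ ^ 2 + ‖c - inner ℂ w u‖ ^ 2 := by
  have h : ((‖u - c • w‖ ^ 2 : ℝ) : ℂ) =
      ((1 - ‖(inner ℂ u w : ℂ)‖ ^ 2 + ‖c - inner ℂ w u‖ ^ 2 : ℝ) : ℂ) := by
    have e : ∀ z : ℂ, ((‖z‖ ^ 2 : ℝ) : ℂ) = (starRingEnd ℂ) z * z := fun z => by
      rw [Complex.conj_mul']; push_cast; rfl
    have e2 : ∀ z : E, ((‖z‖ ^ 2 : ℝ) : ℂ) = inner ℂ z z := fun z => by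
      rw [inner_self_eq_norm_sq_to_K]; push_cast; rfl
    have hu' : inner ℂ u u = (1 : ℂ) := by rw [← e2, hu]; norm_num
    have hw' : inner ℂ w w = (1 : ℂ) := by rw [← e2, hw]; norm_num
    rw [Complex.ofReal_add, Complex.ofReal_sub, e, e, e2]
    simp only [inner_sub_left, inner_sub_right, inner_smul_left, inner_smul_right, hu', hw',
      map_sub, inner_conj_symm, Complex.ofReal_one]
    ring
  exact_mod_cast h

/-- The left side is the distance from `u` to the line `ℂ w`, attained at `c = inner ℂ w u`. -/
theorem sqrt_one_sub_inner_le {u w : E} (hu : ‖u‖ = 1) (hw : ‖w‖ = 1) (c : ℂ) :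
    Real.sqrt (1 - ‖(inner ℂ u w : ℂ)‖ ^ 2) ≤ ‖u - c • w‖ := by
  apply Real.sqrt_le_iff.mpr ⟨norm_nonneg _, ?_⟩
  rw [norm_sub_smul_sq hu hw]
  nlinarith [sq_nonneg ‖c - inner ℂ w u‖]

theorem sqrt_one_sub_inner_eq {u w : E} (hu : ‖u‖ = 1) (hw : ‖w‖ = 1) :
    ‖u - (inner ℂ w u : ℂ) • w‖ = Real.sqrt (1 - ‖(inner ℂ u w : ℂ)‖ ^ 2) := by
  rw [← Real.sqrt_sq (norm_nonneg _), norm_sub_smul_sq hu hw]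
  simp

theorem sqrt_one_sub_inner_triangle {u v w : E} (hu : ‖u‖ = 1) (hv : ‖v‖ = 1) (hw : ‖w‖ = 1) :
    Real.sqrt (1 - ‖(inner ℂ u w : ℂ)‖ ^ 2) ≤
      Real.sqrt (1 - ‖(inner ℂ u v : ℂ)‖ ^ 2) + Real.sqrt (1 - ‖(inner ℂ v w : ℂ)‖ ^ 2) := by
  have h1 : ‖(inner ℂ v u : ℂ)‖ ≤ 1 := by
    simpa [hu, hv] using norm_inner_le_norm (𝕜 := ℂ) v u
  refine (sqrt_one_sub_inner_le hu hw ((inner ℂ v u : ℂ) * inner ℂ w v)).trans ?_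
  -- Project `u` to the line of `v`, then the result to the line of `w`. The second error is scaled
  -- by `|⟨v, u⟩| ≤ 1`.
  have e : u - ((inner ℂ v u : ℂ) * inner ℂ w v) • w =
      (u - (inner ℂ v u : ℂ) • v) + (inner ℂ v u : ℂ) • (v - (inner ℂ w v : ℂ) • w) := by
    rw [smul_sub, smul_smul]; abel
  rw [e, ← sqrt_one_sub_inner_eq hu hv, ← sqrt_one_sub_inner_eq hv hw]
  refine (norm_add_le _ _).trans (add_le_add le_rfl ?_)
  rw [norm_smul]
  exact mul_le_of_le_one_left (norm_nonneg _) h1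

/-- The unit vector obtained from `x` by adding a coordinate. -/
def unitExtend (x : E) : WithLp 2 (E × ℂ) :=
  WithLp.toLp 2 (x, (Real.sqrt (1 - ‖x‖ ^ 2) : ℂ))

theorem inner_unitExtend {x y : E} (hx : ‖x‖ ≤ 1) :
    inner ℂ (unitExtend x) (unitExtend y) =
      inner ℂ x y + (Real.sqrt ((1 - ‖x‖ ^ 2) * (1 - ‖y‖ ^ 2)) : ℂ) := by
  have : 0 ≤ 1 - ‖x‖ ^ 2 := by nlinarith [norm_nonneg x]
  rw [Real.sqrt_mul this]
  simp [unitExtend, WithLp.prod_inner_apply, mul_comm]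

theorem norm_unitExtend {x : E} (hx : ‖x‖ ≤ 1) : ‖unitExtend x‖ = 1 := by
  have h0 : 0 ≤ 1 - ‖x‖ ^ 2 := by nlinarith [norm_nonneg x]
  have h : ((‖unitExtend x‖ ^ 2 : ℝ) : ℂ) = 1 := by
    have := inner_self_eq_norm_sq_to_K (𝕜 := ℂ) (unitExtend x)
    push_cast
    refine this.symm.trans ?_
    rw [inner_unitExtend hx, inner_self_eq_norm_sq_to_K, Real.sqrt_mul_self h0]
    push_cast
    simp
  have h1 : ‖unitExtend x‖ ^ 2 = 1 := by exact_mod_cast h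
  exact (pow_eq_one_iff_of_nonneg (norm_nonneg _) two_ne_zero).mp h1

theorem exists_phase (z : ℂ) : ∃ c : ℂ, ‖c‖ = 1 ∧ c * z = ‖z‖ := by
  by_cases hz : z = 0
  · exact ⟨1, by simp, by simp [hz]⟩
  · refine ⟨(starRingEnd ℂ) z / ‖z‖, ?_, ?_⟩
    · simp [norm_ne_zero_iff.mpr hz]
    · have : (‖z‖ : ℂ) ≠ 0 := by exact_mod_cast norm_ne_zero_iff.mpr hz
      rw [div_mul_eq_mul_div, Complex.conj_mul', sq, mul_div_assoc, div_self this, mul_one]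

theorem pureDist_triangle {x y z : E} (hx : ‖x‖ ≤ 1) (hy : ‖y‖ ≤ 1) (hz : ‖z‖ ≤ 1) :
    pureDist x z ≤ pureDist x y + pureDist y z := by
  -- The added coordinates contribute a nonnegative real overlap. Rotating `x` and `z` makes their
  -- overlaps with `y` nonnegative too, so that the unit vectors have overlap exactly `pureFidelity`
  -- in both pairs with `y`. For the pair `x, z` an inequality suffices.
  obtain ⟨α, hα, hα'⟩ := exists_phase (inner ℂ y x)
  obtain ⟨β, hβ, hβ'⟩ := exists_phase (inner ℂ y z)
  have hαx : ‖α • x‖ = ‖x‖ := by rw [norm_smul, hα, one_mul]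
  have hβz : ‖β • z‖ = ‖z‖ := by rw [norm_smul, hβ, one_mul]
  have h1 : ‖(inner ℂ (unitExtend (α • x)) (unitExtend y) : ℂ)‖ = pureFidelity x y := by
    rw [norm_inner_symm, inner_unitExtend hy, inner_smul_right, hα', hαx,
      pureFidelity_comm, pureFidelity, ← Complex.ofReal_add, Complex.norm_real,
      Real.norm_of_nonneg (add_nonneg (norm_nonneg _) (Real.sqrt_nonneg _))]
  have h2 : ‖(inner ℂ (unitExtend y) (unitExtend (β • z)) : ℂ)‖ = pureFidelity y z := by
    rw [inner_unitExtend hy, inner_smul_right, hβ', hβz,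
      pureFidelity, ← Complex.ofReal_add, Complex.norm_real,
      Real.norm_of_nonneg (add_nonneg (norm_nonneg _) (Real.sqrt_nonneg _))]
  have h3 : ‖(inner ℂ (unitExtend (α • x)) (unitExtend (β • z)) : ℂ)‖ ≤ pureFidelity x z := by
    rw [inner_unitExtend (hαx.trans_le hx), hαx, hβz]
    refine (norm_add_le _ _).trans (le_of_eq ?_)
    rw [inner_smul_left, inner_smul_right, norm_mul, norm_mul, RCLike.norm_conj, hα, hβ,
      one_mul, one_mul, Complex.norm_real, Real.norm_of_nonneg (Real.sqrt_nonneg _), pureFidelity]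
  have h := sqrt_one_sub_inner_triangle (norm_unitExtend (hαx.trans_le hx)) (norm_unitExtend hy)
    (norm_unitExtend (hβz.trans_le hz))
  rw [h1, h2] at h
  refine le_trans (Real.sqrt_le_sqrt ?_) h
  have := pow_le_pow_left₀ (norm_nonneg _) h3 2
  linarith

theorem sqrt_mul_add_sqrt_mul_le {p q r s : ℝ} (hp : 0 ≤ p) (hq : 0 ≤ q) (hr : 0 ≤ r)
    (hs : 0 ≤ s) :
    Real.sqrt (p * q) + Real.sqrt (r * s) ≤ Real.sqrt ((p + r) * (q + s)) := by
  apply Real.le_sqrt_of_sq_le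
  rw [Real.sqrt_mul hp, Real.sqrt_mul hr]
  nlinarith [Real.sq_sqrt hp, Real.sq_sqrt hq, Real.sq_sqrt hr, Real.sq_sqrt hs,
    sq_nonneg (Real.sqrt p * Real.sqrt s - Real.sqrt r * Real.sqrt q)]

/-- Monotonicity under a contraction, given by one component `(x', y')` of an isometric image of
`(x, y)`; the other component is `(x'', y'')`. -/
theorem pureDist_contraction_le {E' E'' : Type*} [NormedAddCommGroup E']
    [InnerProductSpace ℂ E'] [NormedAddCommGroup E''] [InnerProductSpace ℂ E'']
    {x y : E} {x' y' : E'} {x'' y'' : E''}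
    (hx : ‖x‖ ≤ 1) (hy : ‖y‖ ≤ 1)
    (hxx : ‖x‖ ^ 2 = ‖x'‖ ^ 2 + ‖x''‖ ^ 2) (hyy : ‖y‖ ^ 2 = ‖y'‖ ^ 2 + ‖y''‖ ^ 2)
    (hxy : (inner ℂ x y : ℂ) = inner ℂ x' y' + inner ℂ x'' y'') :
    pureDist x' y' ≤ pureDist x y := by
  have h0 : pureFidelity x y ≤ pureFidelity x' y' := by
    unfold pureFidelity
    have h1 : ‖(inner ℂ x y : ℂ)‖ ≤ ‖(inner ℂ x' y' : ℂ)‖ +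
        Real.sqrt (‖x''‖ ^ 2 * ‖y''‖ ^ 2) := by
      rw [hxy]
      refine (norm_add_le _ _).trans (add_le_add le_rfl ?_)
      rw [← mul_pow, Real.sqrt_sq (by positivity)]
      exact norm_inner_le_norm _ _
    have h2 := sqrt_mul_add_sqrt_mul_le (sq_nonneg ‖x''‖) (sq_nonneg ‖y''‖)
      (show 0 ≤ 1 - ‖x‖ ^ 2 by nlinarith [norm_nonneg x])
      (show 0 ≤ 1 - ‖y‖ ^ 2 by nlinarith [norm_nonneg y])
    have h3 : ‖x''‖ ^ 2 + (1 - ‖x‖ ^ 2) = 1 - ‖x'‖ ^ 2 := by linarith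
    have h4 : ‖y''‖ ^ 2 + (1 - ‖y‖ ^ 2) = 1 - ‖y'‖ ^ 2 := by linarith
    rw [h3, h4] at h2
    linarith
  apply Real.sqrt_le_sqrt
  have := pow_le_pow_left₀ (pureFidelity_nonneg x y) h0 2
  linarith

/-- As `‖x'‖ ≤ ‖x‖`, the square-root term of the generalized fidelity is at least `1 - ‖x‖²`, which
cancels the `‖x‖²` in the hypothesis and leaves `√(1 - ε²)`. -/
theorem pureDist_le_of_inner {x x' : E} {ε : ℝ} (hε : 0 ≤ ε) (hε1 : ε ≤ 1) (hx : ‖x‖ ≤ 1)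
    (hx' : ‖x'‖ ≤ ‖x‖)
    (h : ‖x‖ ^ 2 - (1 - Real.sqrt (1 - ε ^ 2)) ≤ ‖(inner ℂ x' x : ℂ)‖) :
    pureDist x' x ≤ ε := by
  have h1 : 1 - ‖x‖ ^ 2 ≤ Real.sqrt ((1 - ‖x'‖ ^ 2) * (1 - ‖x‖ ^ 2)) := by
    have a : 0 ≤ 1 - ‖x‖ ^ 2 := by nlinarith [norm_nonneg x]
    have b : ‖x'‖ ^ 2 ≤ ‖x‖ ^ 2 := pow_le_pow_left₀ (norm_nonneg _) hx' 2
    apply Real.le_sqrt_of_sq_le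
    nlinarith
  have h2 : Real.sqrt (1 - ε ^ 2) ≤ pureFidelity x' x := by unfold pureFidelity; linarith
  have h3 := pow_le_pow_left₀ (Real.sqrt_nonneg _) h2 2
  rw [Real.sq_sqrt (by nlinarith)] at h3
  exact Real.sqrt_le_iff.mpr ⟨hε, by linarith⟩

end PureDistance

/-! ### Purified distance of operators: triangle inequality and monotonicity. -/

section PurifiedDistance

variable {m n d e : Type*} [Fintype m] [DecidableEq m] [Fintype n] [DecidableEq n]
  [Fintype d] [DecidableEq d] [Fintype e] [DecidableEq e]

theorem norm_vec_le_one {M : Matrix n d ℂ} (h : (M * Mᴴ).trace.re ≤ 1) : ‖vec M‖ ≤ 1 := by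
  rw [← norm_vec_sq] at h
  exact (sq_le_one_iff₀ (norm_nonneg _)).mp h

/-- Purified distance is bounded by the distance of purifications. -/
theorem purifiedDist_le_pureDist (M N : Matrix n d ℂ) :
    purifiedDist (M * Mᴴ) (N * Nᴴ) ≤ pureDist (vec M) (vec N) := by
  have h1 : IsContraction (1 : Matrix d d ℂ) := by simp [IsContraction, Matrix.PosSemidef.zero]
  have h2 := norm_trace_le_fidelity M N h1
  rw [Matrix.mul_one, ← inner_vec] at h2
  have h3 : pureFidelity (vec M) (vec N) ≤ genFidelity (M * Mᴴ) (N * Nᴴ) := by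
    unfold pureFidelity genFidelity
    rw [norm_vec_sq, norm_vec_sq]
    linarith
  apply Real.sqrt_le_sqrt
  have := pow_le_pow_left₀ (pureFidelity_nonneg _ _) h3 2
  linarith

theorem fromCols_sqrt_mul {σ : Matrix n n ℂ} (hσ : σ.PosSemidef) :
    Matrix.fromCols (CFC.sqrt σ) (0 : Matrix n n ℂ) *
      (Matrix.fromCols (CFC.sqrt σ) (0 : Matrix n n ℂ))ᴴ = σ := by
  rw [Matrix.conjTranspose_fromCols_eq_fromRows_conjTranspose, Matrix.fromCols_mul_fromRows,
    Matrix.zero_mul, add_zero, sqrt_mul_conjTranspose hσ]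

/-- Uhlmann's theorem for the purified distance. -/
theorem exists_purification_pureDist {ρ σ : Matrix n n ℂ} (hρ : ρ.PosSemidef)
    (hσ : σ.PosSemidef) :
    ∃ M : Matrix n (n ⊕ n) ℂ, M * Mᴴ = ρ ∧
      pureDist (vec M) (vec (Matrix.fromCols (CFC.sqrt σ) (0 : Matrix n n ℂ))) =
        purifiedDist ρ σ := by
  obtain ⟨M, hM, h⟩ := exists_purification hρ hσ
  refine ⟨M, hM, ?_⟩
  rw [pureDist, pureFidelity, inner_vec, h, norm_vec_sq, norm_vec_sq, hM, fromCols_sqrt_mul hσ,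
    Complex.norm_real, Real.norm_of_nonneg (fidelity_nonneg _ _)]
  rfl

/-- Uhlmann purifications of `ρ` and `τ` are both optimal against the same fixed purification of
`σ`, so the vector inequality applies. -/
theorem purifiedDist_triangle {ρ σ τ : Matrix n n ℂ} (hρ : IsSubnormalized ρ)
    (hσ : IsSubnormalized σ) (hτ : IsSubnormalized τ) :
    purifiedDist ρ τ ≤ purifiedDist ρ σ + purifiedDist τ σ := by
  obtain ⟨M, rfl, hM⟩ := exists_purification_pureDist hρ.1 hσ.1
  obtain ⟨N, rfl, hN⟩ := exists_purification_pureDist hτ.1 hσ.1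
  rw [← hM, ← hN]
  refine (purifiedDist_le_pureDist M N).trans ?_
  rw [pureDist_comm (vec N)]
  refine pureDist_triangle (norm_vec_le_one hρ.2) (norm_vec_le_one ?_) (norm_vec_le_one hτ.2)
  rw [fromCols_sqrt_mul hσ.1]
  exact hσ.2

/-- Stacking `T` on its defect operator `D = √(1 - Tᴴ T)` gives an isometry, whose first component
is `T`. -/
theorem pureDist_mul_left_le {T : Matrix m n ℂ} (hT : IsContraction T) {M N : Matrix n d ℂ}
    (hM : ‖vec M‖ ≤ 1) (hN : ‖vec N‖ ≤ 1) :
    pureDist (vec (T * M)) (vec (T * N)) ≤ pureDist (vec M) (vec N) := by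
  set D := CFC.sqrt (1 - Tᴴ * T) with hD
  have hDs : Dᴴ = D := (sqrt_posSemidef _).1.eq
  have hDD : D * D = 1 - Tᴴ * T := sqrt_mul_sqrt hT
  have key : ∀ X Y : Matrix n d ℂ, (inner ℂ (vec X) (vec Y) : ℂ) =
      inner ℂ (vec (T * X)) (vec (T * Y)) + inner ℂ (vec (D * X)) (vec (D * Y)) := by
    intro X Y
    simp only [inner_vec, ← Matrix.trace_add, Matrix.conjTranspose_mul]
    congr 1
    calc Xᴴ * Y = Xᴴ * (Tᴴ * T + D * D) * Y := by
          rw [hDD, add_sub_cancel, Matrix.mul_one]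
      _ = _ := by rw [hDs]; simp only [Matrix.mul_add, Matrix.add_mul, Matrix.mul_assoc]
  have key' : ∀ X : Matrix n d ℂ, ‖vec X‖ ^ 2 = ‖vec (T * X)‖ ^ 2 + ‖vec (D * X)‖ ^ 2 := by
    intro X
    have := congrArg Complex.re (key X X)
    simp only [Complex.add_re] at this
    simp only [← inner_self_eq_norm_sq (𝕜 := ℂ)]
    exact this
  exact pureDist_contraction_le hM hN (key' M) (key' N) (key M N)

theorem norm_vec_conjTranspose (M : Matrix n d ℂ) : ‖vec Mᴴ‖ = ‖vec M‖ := by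
  have : ‖vec Mᴴ‖ ^ 2 = ‖vec M‖ ^ 2 := by
    rw [norm_vec_sq, norm_vec_sq, Matrix.conjTranspose_conjTranspose, Matrix.trace_mul_comm]
  exact (sq_eq_sq₀ (norm_nonneg _) (norm_nonneg _)).mp this

theorem pureDist_conjTranspose (M N : Matrix n d ℂ) :
    pureDist (vec Mᴴ) (vec Nᴴ) = pureDist (vec M) (vec N) := by
  rw [pureDist_comm, pureDist, pureDist, pureFidelity, pureFidelity, norm_vec_conjTranspose,
    norm_vec_conjTranspose, inner_vec, inner_vec, Matrix.conjTranspose_conjTranspose,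
    Matrix.trace_mul_comm N, mul_comm]

theorem pureDist_mul_right_le {T : Matrix d e ℂ} (hT : IsContraction T) {M N : Matrix n d ℂ}
    (hM : ‖vec M‖ ≤ 1) (hN : ‖vec N‖ ≤ 1) :
    pureDist (vec (M * T)) (vec (N * T)) ≤ pureDist (vec M) (vec N) := by
  rw [← pureDist_conjTranspose, ← pureDist_conjTranspose M, Matrix.conjTranspose_mul,
    Matrix.conjTranspose_mul]
  exact pureDist_mul_left_le hT.conjTranspose (by rwa [norm_vec_conjTranspose])
    (by rwa [norm_vec_conjTranspose])

theorem IsContraction.norm_vec_mul_right_le {K : Matrix d e ℂ} (hK : IsContraction K)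
    (M : Matrix n d ℂ) : ‖vec (M * K)‖ ≤ ‖vec M‖ := by
  rw [← norm_vec_conjTranspose, ← norm_vec_conjTranspose M, Matrix.conjTranspose_mul]
  exact hK.conjTranspose.norm_vec_mul_le _

theorem IsSubnormalized.conj {T : Matrix m n ℂ} (hT : IsContraction T) {ρ : Matrix n n ℂ}
    (hρ : IsSubnormalized ρ) : IsSubnormalized (T * ρ * Tᴴ) := by
  refine ⟨hρ.1.mul_mul_conjTranspose_same T, ?_⟩
  have h := hT.norm_vec_mul_le (CFC.sqrt ρ)
  have h2 := pow_le_pow_left₀ (norm_nonneg _) h 2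
  rw [norm_vec_sq, norm_vec_sq, sqrt_mul_conjTranspose hρ.1, Matrix.conjTranspose_mul,
    Matrix.mul_assoc, ← Matrix.mul_assoc (CFC.sqrt ρ), sqrt_mul_conjTranspose hρ.1,
    ← Matrix.mul_assoc] at h2
  exact h2.trans hρ.2

theorem purifiedDist_conj_le {T : Matrix m n ℂ} (hT : IsContraction T) {ρ σ : Matrix n n ℂ}
    (hρ : IsSubnormalized ρ) (hσ : IsSubnormalized σ) :
    purifiedDist (T * ρ * Tᴴ) (T * σ * Tᴴ) ≤ purifiedDist ρ σ := by
  obtain ⟨M, rfl, hM⟩ := exists_purification_pureDist hρ.1 hσ.1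
  set N := Matrix.fromCols (CFC.sqrt σ) (0 : Matrix n n ℂ)
  have hN : N * Nᴴ = σ := fromCols_sqrt_mul hσ.1
  have e : ∀ X : Matrix n (n ⊕ n) ℂ, T * (X * Xᴴ) * Tᴴ = (T * X) * (T * X)ᴴ := fun X => by
    rw [Matrix.conjTranspose_mul]; simp only [Matrix.mul_assoc]
  rw [← hM, ← hN, e, e]
  exact (purifiedDist_le_pureDist _ _).trans (pureDist_mul_left_le hT (norm_vec_le_one hρ.2)
    (norm_vec_le_one (by rw [hN]; exact hσ.2)))

end PurifiedDistance

/-! ### Partial traces by moving `A` to the purifying side, and the tests used for the max-entropy.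
-/

section PartialTrace

variable {a n d e : Type*} [Fintype a] [DecidableEq a] [Fintype n] [DecidableEq n]
  [Fintype d] [DecidableEq d] [Fintype e] [DecidableEq e]

/-- Moving a tensor factor from the row to the column index. -/
def bend (M : Matrix (a × n) d ℂ) : Matrix n (a × d) ℂ :=
  Matrix.of fun i p => M (p.1, i) p.2

/-- The inverse of `bend`. -/
def unbend (M : Matrix n (a × d) ℂ) : Matrix (a × n) d ℂ :=
  Matrix.of fun p k => M p.2 (p.1, k)

theorem bend_unbend (M : Matrix n (a × d) ℂ) : bend (unbend M) = M := rfl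

theorem bend_mul_conjTranspose (M : Matrix (a × n) d ℂ) :
    bend M * (bend M)ᴴ = traceFst (M * Mᴴ) := by
  ext i j
  simp [bend, traceFst, Matrix.mul_apply, Fintype.sum_prod_type]

theorem trace_bend (M N : Matrix (a × n) d ℂ) :
    ((bend M)ᴴ * bend N).trace = (Mᴴ * N).trace := by
  simp only [bend, Matrix.trace, Matrix.diag, Matrix.mul_apply, Fintype.sum_prod_type,
    Matrix.conjTranspose_apply, Matrix.of_apply]
  rw [Finset.sum_comm]

theorem norm_vec_bend (M : Matrix (a × n) d ℂ) : ‖vec (bend M)‖ = ‖vec M‖ := by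
  have : ‖vec (bend M)‖ ^ 2 = ‖vec M‖ ^ 2 := by
    rw [norm_vec_sq, norm_vec_sq, Matrix.trace_mul_comm, trace_bend, Matrix.trace_mul_comm]
  exact (sq_eq_sq₀ (norm_nonneg _) (norm_nonneg _)).mp this

theorem pureDist_bend (M N : Matrix (a × n) d ℂ) :
    pureDist (vec (bend M)) (vec (bend N)) = pureDist (vec M) (vec N) := by
  rw [pureDist, pureDist, pureFidelity, pureFidelity, norm_vec_bend, norm_vec_bend, inner_vec,
    inner_vec, trace_bend]

theorem bend_kronecker_mul (S : Matrix n e ℂ) (X : Matrix (a × e) d ℂ) :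
    bend (((1 : Matrix a a ℂ) ⊗ₖ S) * X) = S * bend X := by
  ext i ⟨x, k⟩
  simp [bend, Matrix.mul_apply, Fintype.sum_prod_type, Matrix.one_apply]

theorem unbend_conjTranspose_mul (J : Matrix e (a × d) ℂ) :
    (unbend J)ᴴ * unbend J = traceFst (Jᴴ * J) := by
  ext i j
  simp [unbend, traceFst, Matrix.mul_apply, Fintype.sum_prod_type]

theorem traceFst_add (A B : Matrix (a × d) (a × d) ℂ) :
    traceFst (A + B) = traceFst A + traceFst B := by
  ext i j; simp [traceFst, Finset.sum_add_distrib]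

theorem traceFst_sub (A B : Matrix (a × d) (a × d) ℂ) :
    traceFst (A - B) = traceFst A - traceFst B := by
  ext i j; simp [traceFst, Finset.sum_sub_distrib]

theorem traceFst_posSemidef {A : Matrix (a × d) (a × d) ℂ} (hA : A.PosSemidef) :
    (traceFst A).PosSemidef := by
  have : traceFst A = ∑ i, A.submatrix (fun j => (i, j)) (fun j => (i, j)) := by
    ext i j; simp [traceFst, Matrix.sum_apply]
  rw [this]
  exact Matrix.posSemidef_sum _ fun i _ => hA.submatrix _

theorem trace_traceFst (A : Matrix (a × d) (a × d) ℂ) : (traceFst A).trace = A.trace := by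
  simp only [traceFst, Matrix.trace, Matrix.diag, Matrix.of_apply, Fintype.sum_prod_type]
  rw [Finset.sum_comm]

theorem IsSubnormalized.traceFst {ρ : Matrix (a × d) (a × d) ℂ} (h : IsSubnormalized ρ) :
    IsSubnormalized (traceFst ρ) :=
  ⟨traceFst_posSemidef h.1, by rw [trace_traceFst]; exact h.2⟩

theorem trace_kronecker_one_mul (T : Matrix n n ℂ) (ρ : Matrix (a × n) (a × n) ℂ) :
    (((1 : Matrix a a ℂ) ⊗ₖ T) * ρ).trace = (T * traceFst ρ).trace := by
  simp only [traceFst, Matrix.trace, Matrix.diag, Matrix.mul_apply, Fintype.sum_prod_type,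
    Matrix.kroneckerMap_apply, Matrix.one_apply, Matrix.of_apply, Finset.mul_sum]
  simp only [ite_mul, one_mul, zero_mul, Finset.sum_ite_irrel, Finset.sum_const_zero,
    Finset.sum_ite_eq, Finset.mem_univ, if_true]
  rw [Finset.sum_comm]
  exact Finset.sum_congr rfl fun i _ => Finset.sum_comm

theorem traceFst_conj_bend (N : Matrix (a × n) d ℂ) (A : Matrix n n ℂ) :
    traceFst ((bend N)ᴴ * A * bend N) = Nᴴ * ((1 : Matrix a a ℂ) ⊗ₖ A) * N := by
  rw [Matrix.mul_assoc, Matrix.mul_assoc, ← bend_kronecker_mul]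
  ext i j
  simp [traceFst, bend, Matrix.mul_apply, Fintype.sum_prod_type]

theorem posSemidef_sub_mul_self {T : Matrix d d ℂ} (hT : T.PosSemidef)
    (hT1 : (1 - T).PosSemidef) : (T - T * T).PosSemidef := by
  have h1 := hT1.mul_mul_conjTranspose_same T
  have h2 := hT.mul_mul_conjTranspose_same (1 - T)
  rw [hT.1.eq] at h1
  rw [hT1.1.eq] at h2
  convert h1.add h2 using 1
  noncomm_ring

theorem isContraction_of_posSemidef {T : Matrix d d ℂ} (hT : T.PosSemidef)
    (hT1 : (1 - T).PosSemidef) : IsContraction T := by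
  unfold IsContraction
  rw [hT.1.eq]
  convert hT1.add (posSemidef_sub_mul_self hT hT1) using 1
  abel

/-- A test operator on the purifying systems with small partial trace and almost full weight. -/
theorem exists_test_of_le {N : Matrix (a × n) d ℂ} {σ : Matrix n n ℂ} {s μ : ℝ}
    (hs : 0 < s) (hμ : 0 < μ) (hσ : σ.PosDef) (hσ1 : σ.trace.re ≤ 1)
    (h : (s • ((1 : Matrix a a ℂ) ⊗ₖ σ) - N * Nᴴ).PosSemidef) :
    ∃ T : Matrix (a × d) (a × d) ℂ, T.PosSemidef ∧ (1 - T).PosSemidef ∧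
      (μ • (1 : Matrix d d ℂ) - traceFst T).PosSemidef ∧
      (N * Nᴴ).trace.re - s / μ ≤ (T * ((bend N)ᴴ * bend N)).trace.re := by
  set B := bend N with hB
  have hω : (B * Bᴴ).PosSemidef := Matrix.posSemidef_self_mul_conjTranspose B
  set Δ := s • σ with hΔ
  have hΔp : Δ.PosDef := hσ.smul hs
  -- `Λ` dominates both `μ B Bᴴ`, which gives `T ≤ 1`, and `Δ = s σ`, which gives `N Nᴴ ≤ 1 ⊗ Λ` and
  -- hence `tr_A T = μ Nᴴ (1 ⊗ Λ⁻¹) N ≤ μ`. Both follow from `schur_le_one`.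
  set Λ := μ • (B * Bᴴ) + Δ with hΛ
  have hΛp : Λ.PosDef := Matrix.PosDef.posSemidef_add (hω.smul hμ.le) hΔp
  have hΛi : Λ⁻¹.PosDef := hΛp.inv
  have hinv : Λ * Λ⁻¹ = 1 := Matrix.mul_nonsing_inv _ ((Matrix.isUnit_iff_isUnit_det _).mp hΛp.isUnit)
  have hinv' : Λ⁻¹ * Λ = 1 := Matrix.nonsing_inv_mul _ ((Matrix.isUnit_iff_isUnit_det _).mp hΛp.isUnit)
  refine ⟨μ • (Bᴴ * Λ⁻¹ * B), (hΛi.posSemidef.conjTranspose_mul_mul_same B).smul hμ.le,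
    ?_, ?_, ?_⟩
  · have h1 : (Λ - (((Real.sqrt μ : ℝ) : ℂ) • B) * (((Real.sqrt μ : ℝ) : ℂ) • B)ᴴ).PosSemidef := by
      have : (((Real.sqrt μ : ℝ) : ℂ) • B) * (((Real.sqrt μ : ℝ) : ℂ) • B)ᴴ = μ • (B * Bᴴ) := by
        rw [Matrix.conjTranspose_smul, Matrix.smul_mul, Matrix.mul_smul, smul_smul]
        simp only [RCLike.star_def, Complex.conj_ofReal]
        rw [← Complex.ofReal_mul, Real.mul_self_sqrt hμ.le, Complex.coe_smul]
      rw [this, hΛ, add_sub_cancel_left]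
      exact hΔp.posSemidef
    have h2 := schur_le_one hΛp h1
    convert h2 using 2
    rw [Matrix.conjTranspose_smul, Matrix.smul_mul, Matrix.smul_mul, Matrix.mul_smul, smul_smul]
    simp only [RCLike.star_def, Complex.conj_ofReal]
    rw [← Complex.ofReal_mul, Real.mul_self_sqrt hμ.le, Complex.coe_smul]
  · have h1 : ((1 : Matrix a a ℂ) ⊗ₖ Λ - N * Nᴴ).PosSemidef := by
      have h2 : ((1 : Matrix a a ℂ) ⊗ₖ (μ • (B * Bᴴ))).PosSemidef :=
        Matrix.PosSemidef.one.kronecker (hω.smul hμ.le)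
      convert h.add h2 using 1
      rw [hΛ, hΔ, Matrix.kronecker_add, Matrix.kronecker_smul s]
      abel
    have h2 := schur_le_one (Matrix.PosDef.one.kronecker hΛp) h1
    have h3 : ((1 : Matrix a a ℂ) ⊗ₖ Λ)⁻¹ = (1 : Matrix a a ℂ) ⊗ₖ Λ⁻¹ := by
      rw [Matrix.inv_kronecker]; simp
    rw [h3, ← traceFst_conj_bend] at h2
    have h4 := h2.smul hμ.le
    convert h4 using 1
    rw [smul_sub]
    congr 1
    ext i j
    simp [traceFst, Finset.mul_sum, hB]
  -- Up to the factor `μ⁻¹`, the weight is `tr (Λ - Δ) Λ⁻¹ (Λ - Δ) = tr (Λ - 2Δ + Δ Λ⁻¹ Δ)`.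
  -- Dropping the last, nonnegative term loses at most `tr Δ / μ ≤ s / μ`.
  · have hA : μ • (B * Bᴴ) = Λ - Δ := by rw [hΛ, add_sub_cancel_right]
    have e1 : (μ • (Bᴴ * Λ⁻¹ * B) * (Bᴴ * B)).trace =
        ((μ⁻¹ : ℝ) : ℂ) * (Λ - Δ - Δ + Δ * Λ⁻¹ * Δ).trace := by
      have : Λ - Δ - Δ + Δ * Λ⁻¹ * Δ = (μ • (B * Bᴴ)) * Λ⁻¹ * (μ • (B * Bᴴ)) := by
        rw [hA]
        calc _ = (Λ * Λ⁻¹) * Λ - (Λ * Λ⁻¹) * Δ - Δ * (Λ⁻¹ * Λ) + Δ * Λ⁻¹ * Δ := by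
              rw [hinv, hinv', Matrix.one_mul, Matrix.one_mul, Matrix.mul_one]
          _ = _ := by noncomm_ring
      rw [this]
      simp only [Matrix.smul_mul, Matrix.mul_smul, Matrix.trace_smul, Complex.real_smul]
      rw [← mul_assoc, ← mul_assoc, ← Complex.ofReal_mul, inv_mul_cancel₀ hμ.ne',
        Complex.ofReal_one, one_mul]
      congr 1
      rw [Matrix.trace_mul_comm]
      simp only [Matrix.mul_assoc]
      rw [Matrix.trace_mul_comm]
      simp only [Matrix.mul_assoc]
    have h5 : 0 ≤ (Δ * Λ⁻¹ * Δ).trace.re := by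
      have := trace_re_nonneg (hΛi.posSemidef.mul_mul_conjTranspose_same Δ)
      rwa [hΔp.1.eq] at this
    have h6 : (N * Nᴴ).trace = (B * Bᴴ).trace := by
      rw [hB, bend_mul_conjTranspose, trace_traceFst]
    have h7 : Δ.trace.re ≤ s := by
      rw [hΔ, Matrix.trace_smul, Complex.smul_re, smul_eq_mul]
      nlinarith
    have h8 : (Λ - Δ).trace.re = μ * (B * Bᴴ).trace.re := by
      rw [← hA, Matrix.trace_smul, Complex.smul_re, smul_eq_mul]
    rw [e1, h6, Complex.re_ofReal_mul, Matrix.trace_add, Matrix.trace_sub, Complex.add_re,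
      Complex.sub_re, h8]
    have h9 : (B * Bᴴ).trace.re - s / μ = μ⁻¹ * (μ * (B * Bᴴ).trace.re - s) := by
      field_simp
    rw [h9]
    apply mul_le_mul_of_nonneg_left _ (inv_nonneg.mpr hμ.le)
    linarith

/-- A test operator on the purifying system decreases the fidelity with `1 ⊗ S Sᴴ`. -/
theorem fidelity_bend_mul_le {M : Matrix (a × n) d ℂ} {T : Matrix (a × d) (a × d) ℂ} {μ : ℝ}
    (hμ : 0 < μ) (hT : T.PosSemidef) (hT1 : (1 - T).PosSemidef)
    (hTμ : (μ • (1 : Matrix d d ℂ) - traceFst T).PosSemidef) (S : Matrix n e ℂ) :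
    fidelity ((bend M * T) * (bend M * T)ᴴ) (S * Sᴴ) ≤
      Real.sqrt μ * fidelity (M * Mᴴ)
        (((1 : Matrix a a ℂ) ⊗ₖ S) * ((1 : Matrix a a ℂ) ⊗ₖ S)ᴴ) := by
  obtain ⟨K, hK, hF⟩ := exists_trace_eq_fidelity (bend M * T) S
  set J := unbend (K * T) with hJ
  set r := Real.sqrt μ
  have hr : 0 < r := Real.sqrt_pos.mpr hμ
  have hrr : r * r = μ := Real.mul_self_sqrt hμ.le
  -- `Jᴴ J = tr_A (T Kᴴ K T) ≤ tr_A T² ≤ tr_A T ≤ μ`, so `J / √μ` is an admissible contraction for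
  -- the fidelity of `M Mᴴ`.
  have h1 : (μ • (1 : Matrix d d ℂ) - Jᴴ * J).PosSemidef := by
    have h2 := traceFst_posSemidef (hK.mul_mul_conjTranspose_same T)
    have h3 := traceFst_posSemidef (posSemidef_sub_mul_self hT hT1)
    convert (hTμ.add h3).add h2 using 1
    rw [hJ, unbend_conjTranspose_mul, add_assoc, ← traceFst_add, sub_add, ← traceFst_sub]
    congr 2
    rw [Matrix.conjTranspose_mul, hT.1.eq]
    simp only [Matrix.mul_sub, Matrix.sub_mul, Matrix.mul_one, Matrix.mul_assoc]
    abel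
  have h2 : IsContraction (((r⁻¹ : ℝ) : ℂ) • J) := by
    unfold IsContraction
    have := h1.smul (inv_nonneg.mpr hμ.le)
    convert this using 1
    rw [smul_sub, smul_smul, inv_mul_cancel₀ hμ.ne', one_smul, Matrix.conjTranspose_smul,
      Matrix.smul_mul, Matrix.mul_smul, smul_smul]
    simp only [RCLike.star_def, Complex.conj_ofReal]
    rw [← Complex.ofReal_mul, ← mul_inv, hrr, Complex.coe_smul]
  have h3 := norm_trace_le_fidelity M ((1 : Matrix a a ℂ) ⊗ₖ S) h2
  have h4 : (((bend M * T)ᴴ * S * K).trace) = (Mᴴ * ((1 : Matrix a a ℂ) ⊗ₖ S) * J).trace := by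
    rw [Matrix.mul_assoc Mᴴ, ← trace_bend, bend_kronecker_mul, hJ, bend_unbend,
      Matrix.conjTranspose_mul, hT.1.eq]
    simp only [Matrix.mul_assoc]
    rw [Matrix.trace_mul_comm]
    simp only [Matrix.mul_assoc]
  rw [Matrix.mul_smul, Matrix.trace_smul, ← h4, hF, smul_eq_mul, ← Complex.ofReal_mul,
    Complex.norm_real, Real.norm_of_nonneg (mul_nonneg (inv_nonneg.mpr hr.le)
      (fidelity_nonneg _ _))] at h3
  rwa [inv_mul_le_iff₀ hr] at h3

end PartialTrace

/-! ### Smoothing for the max-entropy inequality, and reindexing. -/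

section Smoothing

variable {a n d e : Type*} [Fintype a] [DecidableEq a] [Fintype n] [DecidableEq n]
  [Fintype d] [DecidableEq d] [Fintype e] [DecidableEq e]

/-- Mixing with the maximally mixed state makes `σ` invertible at the price `σ ≤ κ⁻¹ σ'`. With `κ =
2^(-f(ε))` this price is one of the two error terms. -/
theorem exists_posDef_subnormalized [Nonempty n] {σ : Matrix n n ℂ} (hσ : IsSubnormalized σ)
    {κ : ℝ} (hκ : 0 < κ) (hκ1 : κ < 1) :
    ∃ σ' : Matrix n n ℂ, σ'.PosDef ∧ σ'.trace.re ≤ 1 ∧ (σ' - κ • σ).PosSemidef := by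
  have hN : (0 : ℝ) < Fintype.card n := by exact_mod_cast Fintype.card_pos
  have h1 : (((1 - κ) / Fintype.card n : ℝ) • (1 : Matrix n n ℂ)).PosDef :=
    Matrix.PosDef.one.smul (div_pos (by linarith) hN)
  refine ⟨κ • σ + ((1 - κ) / Fintype.card n : ℝ) • (1 : Matrix n n ℂ), ?_, ?_, ?_⟩
  · exact Matrix.PosDef.posSemidef_add (hσ.1.smul hκ.le) h1
  · rw [Matrix.trace_add, Matrix.trace_smul, Matrix.trace_smul, Matrix.trace_one,
      Complex.add_re, Complex.smul_re, Complex.smul_re, Complex.natCast_re, smul_eq_mul,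
      smul_eq_mul, div_mul_cancel₀ _ hN.ne']
    nlinarith [hσ.2]
  · rw [add_sub_cancel_left]
    exact h1.posSemidef

/-- The route is `M T`, `R T`, `N T`, `N`, `R`. The test contracts the first two steps, and its
effect is only known on `N`; hence the factor 2. -/
theorem pureDist_chain {M R N : Matrix n d ℂ} {T : Matrix d d ℂ} {ε : ℝ}
    (hM : ‖vec M‖ ≤ 1) (hR : ‖vec R‖ ≤ 1) (hN : ‖vec N‖ ≤ 1) (hT : IsContraction T)
    (hε : 0 ≤ ε) (hε1 : ε ≤ 1)
    (h : ‖vec N‖ ^ 2 - (1 - Real.sqrt (1 - ε ^ 2)) ≤ ‖((N * T)ᴴ * N).trace‖) :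
    pureDist (vec (M * T)) (vec R) ≤
      ε + pureDist (vec M) (vec R) + 2 * pureDist (vec N) (vec R) := by
  have hc : ∀ {X : Matrix n d ℂ}, ‖vec X‖ ≤ 1 → ‖vec (X * T)‖ ≤ 1 := fun {X} hX =>
    (hT.norm_vec_mul_right_le X).trans hX
  have h1 := pureDist_triangle (hc hM) (hc hR) hR
  have h2 := pureDist_triangle (hc hR) (hc hN) hR
  have h3 := pureDist_triangle (hc hN) hN hR
  have h4 := pureDist_mul_right_le hT hM hR
  have h5 := pureDist_mul_right_le hT hR hN
  have h6 : pureDist (vec (N * T)) (vec N) ≤ ε :=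
    pureDist_le_of_inner hε hε1 hN (hT.norm_vec_mul_right_le N) (by rwa [inner_vec])
  rw [pureDist_comm (vec R) (vec N)] at h5
  linarith

theorem re_le_norm_trace (A : Matrix n n ℂ) : A.trace.re ≤ ‖A.trace‖ :=
  (le_abs_self _).trans (Complex.abs_re_le_norm _)

/-- From a nearby operator `ω ≤ s (1 ⊗ σ)`, a smoothing of the marginal of `τ` whose fidelities
with positive operators are small compared to those of `τ`. -/
theorem exists_smoothing_fidelity_le [Nonempty n] {ρ τ ω : Matrix (a × n) (a × n) ℂ}
    {σ : Matrix n n ℂ} {s ε : ℝ} (hρ : IsSubnormalized ρ) (hτ : IsSubnormalized τ)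
    (hω : IsSubnormalized ω) (hσ : IsSubnormalized σ) (hε : 0 < ε) (hε1 : ε < 1) (hs : 0 < s)
    (h : (s • ((1 : Matrix a a ℂ) ⊗ₖ σ) - ω).PosSemidef) :
    ∃ ν : Matrix n n ℂ, IsSubnormalized ν ∧
      purifiedDist ν (traceFst ρ) ≤ ε + purifiedDist τ ρ + 2 * purifiedDist ω ρ ∧
      ∀ S : Matrix n n ℂ, fidelity ν (S * Sᴴ) ≤
        Real.sqrt (s / (1 - Real.sqrt (1 - ε ^ 2)) ^ 2) * fidelity τ
          (((1 : Matrix a a ℂ) ⊗ₖ S) * ((1 : Matrix a a ℂ) ⊗ₖ S)ᴴ) := by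
  have hq0 : 0 < Real.sqrt (1 - ε ^ 2) := Real.sqrt_pos.mpr (by nlinarith)
  have hq1 : Real.sqrt (1 - ε ^ 2) < 1 := by
    rw [Real.sqrt_lt' one_pos]; nlinarith
  set κ := 1 - Real.sqrt (1 - ε ^ 2) with hκdef
  have hκ : 0 < κ := by linarith
  have hκ1 : κ < 1 := by linarith
  obtain ⟨σ', hσ', hσ't, hσσ'⟩ := exists_posDef_subnormalized hσ hκ hκ1
  obtain ⟨M, rfl, hM⟩ := exists_purification_pureDist hτ.1 hρ.1
  obtain ⟨N, rfl, hN⟩ := exists_purification_pureDist hω.1 hρ.1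
  set R := Matrix.fromCols (CFC.sqrt ρ) (0 : Matrix (a × n) (a × n) ℂ)
  have hR : R * Rᴴ = ρ := fromCols_sqrt_mul hρ.1
  -- Replacing `σ` by `σ'` turns `s` into `s / κ`. This `μ` then makes the weight loss `(s / κ) / μ`
  -- equal to `κ`, the loss allowed by `pureDist_le_of_inner`.
  set μ := s / κ ^ 2 with hμdef
  have hμ : 0 < μ := by positivity
  have h' : ((s / κ) • ((1 : Matrix a a ℂ) ⊗ₖ σ') - N * Nᴴ).PosSemidef := by
    have h2 : ((1 : Matrix a a ℂ) ⊗ₖ (σ' - κ • σ)).PosSemidef :=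
      Matrix.PosSemidef.one.kronecker hσσ'
    have h3 := h.add (h2.smul (div_pos hs hκ).le)
    convert h3 using 1
    have : (1 : Matrix a a ℂ) ⊗ₖ σ' = (1 : Matrix a a ℂ) ⊗ₖ (σ' - κ • σ) +
        κ • ((1 : Matrix a a ℂ) ⊗ₖ σ) := by
      rw [← Matrix.kronecker_smul κ, ← Matrix.kronecker_add, sub_add_cancel]
    rw [this, smul_add, smul_smul, div_mul_cancel₀ _ hκ.ne']
    abel
  obtain ⟨T, hT, hT1, hTμ, hTr⟩ := exists_test_of_le (div_pos hs hκ) hμ hσ' hσ't h'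
  have hTc := isContraction_of_posSemidef hT hT1
  have hM1 : ‖vec (bend M)‖ ≤ 1 := by rw [norm_vec_bend]; exact norm_vec_le_one hτ.2
  have hN1 : ‖vec (bend N)‖ ≤ 1 := by rw [norm_vec_bend]; exact norm_vec_le_one hω.2
  have hR1 : ‖vec (bend R)‖ ≤ 1 := by
    rw [norm_vec_bend]; exact norm_vec_le_one (by rw [hR]; exact hρ.2)
  have hloss : s / κ / μ = κ := by rw [hμdef]; field_simp
  refine ⟨(bend M * T) * (bend M * T)ᴴ, ⟨Matrix.posSemidef_self_mul_conjTranspose _, ?_⟩, ?_, ?_⟩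
  · rw [← norm_vec_sq]
    exact pow_le_one₀ (norm_nonneg _) ((hTc.norm_vec_mul_right_le _).trans hM1)
  · have h5 := pureDist_chain (ε := ε) hM1 hR1 hN1 hTc hε.le hε1.le (by
      rw [norm_vec_bend, norm_vec_sq, Matrix.conjTranspose_mul, hT.1.eq, Matrix.mul_assoc]
      refine le_trans ?_ (re_le_norm_trace _)
      rwa [hloss] at hTr)
    rw [pureDist_bend, pureDist_bend, hM, hN] at h5
    rw [← hR, ← bend_mul_conjTranspose]
    rw [hR]
    exact (purifiedDist_le_pureDist _ _).trans h5
  · exact fun S => fidelity_bend_mul_le hμ hT hT1 hTμ S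

theorem sqrt_submatrix {m : Type*} [Fintype m] [DecidableEq m] (f : m ≃ n) {A : Matrix n n ℂ}
    (hA : A.PosSemidef) : CFC.sqrt (A.submatrix f f) = (CFC.sqrt A).submatrix f f := by
  refine CFC.sqrt_unique ?_ (Matrix.nonneg_iff_posSemidef.mpr ((sqrt_posSemidef A).submatrix f))
  rw [Matrix.submatrix_mul_equiv, sqrt_mul_sqrt hA]

theorem trace_submatrix_equiv {m : Type*} [Fintype m] (f : m ≃ n) (A : Matrix n n ℂ) :
    (A.submatrix f f).trace = A.trace := by
  simp only [Matrix.trace, Matrix.diag, Matrix.submatrix_apply]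
  exact f.sum_comp fun i => A i i

theorem fidelity_submatrix {m : Type*} [Fintype m] [DecidableEq m] (f : m ≃ n)
    {ρ σ : Matrix n n ℂ} (hρ : ρ.PosSemidef) (hσ : σ.PosSemidef) :
    fidelity (ρ.submatrix f f) (σ.submatrix f f) = fidelity ρ σ := by
  rw [fidelity, fidelity, sqrt_submatrix f hρ, sqrt_submatrix f hσ,
    Matrix.submatrix_mul_equiv, traceNorm, traceNorm, Matrix.conjTranspose_submatrix,
    Matrix.submatrix_mul_equiv, sqrt_submatrix f (Matrix.posSemidef_conjTranspose_mul_self _),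
    trace_submatrix_equiv]

theorem purifiedDist_submatrix {m : Type*} [Fintype m] [DecidableEq m] (f : m ≃ n)
    {ρ σ : Matrix n n ℂ} (hρ : ρ.PosSemidef) (hσ : σ.PosSemidef) :
    purifiedDist (ρ.submatrix f f) (σ.submatrix f f) = purifiedDist ρ σ := by
  rw [purifiedDist, purifiedDist, genFidelity, genFidelity, fidelity_submatrix f hρ hσ,
    trace_submatrix_equiv, trace_submatrix_equiv]

theorem IsSubnormalized.submatrix {m : Type*} [Fintype m] [DecidableEq m] (f : m ≃ n)
    {ρ : Matrix n n ℂ} (hρ : IsSubnormalized ρ) : IsSubnormalized (ρ.submatrix f f) :=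
  ⟨hρ.1.submatrix f, by rw [trace_submatrix_equiv]; exact hρ.2⟩

end Smoothing

/-! ### Variational bound for the fidelity and its minimax form. -/

section Minimax

variable {b c n : Type*} [Fintype b] [DecidableEq b] [Fintype c] [DecidableEq c]
  [Fintype n] [DecidableEq n]

/-- With `S = √X` and `B = √(S ω S)`, whose trace is the fidelity, the formal optimum is `Q = S⁻¹ B
S⁻¹`, `P = Q⁻¹ = S B⁻¹ S`, where both traces equal `tr B`. Small multiples of the identity are added
to `B` and `S` to make them invertible, at total cost `δ`. -/
theorem exists_variational {ω X : Matrix n n ℂ} (hω : ω.PosSemidef) (hX : X.PosSemidef) {δ : ℝ}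
    (hδ : 0 < δ) :
    ∃ P Q : Matrix n n ℂ, (Matrix.fromBlocks P 1 1 Q).PosSemidef ∧
      (ω * P).trace.re + (X * Q).trace.re ≤ 2 * fidelity ω X + δ := by
  set S := CFC.sqrt X with hS
  have hSp : S.PosSemidef := sqrt_posSemidef X
  have hSS : S * S = X := sqrt_mul_sqrt hX
  have hωs : (CFC.sqrt ω)ᴴ = CFC.sqrt ω := (sqrt_posSemidef ω).1.eq
  set A := (CFC.sqrt ω * S)ᴴ * (CFC.sqrt ω * S) with hA
  have hA' : A = S * ω * S := by
    rw [hA, Matrix.conjTranspose_mul, hSp.1.eq, hωs, Matrix.mul_assoc,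
      ← Matrix.mul_assoc (CFC.sqrt ω), sqrt_mul_sqrt hω, Matrix.mul_assoc]
  set B := CFC.sqrt A with hB
  have hBp : B.PosSemidef := sqrt_posSemidef A
  have hBB : B * B = S * ω * S := by
    rw [← hA']; exact sqrt_mul_sqrt (Matrix.posSemidef_conjTranspose_mul_self _)
  have hF : fidelity ω X = B.trace.re := rfl
  obtain ⟨N, hN⟩ : ∃ N : ℝ, N = Fintype.card n := ⟨_, rfl⟩
  have hN0 : 0 ≤ N := hN ▸ Nat.cast_nonneg _
  set β := δ / (2 * (N + 1)) with hβdef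
  have hβ : 0 < β := by positivity
  have hβN : β * N ≤ δ / 2 := by
    rw [hβdef, div_mul_eq_mul_div, div_le_div_iff₀ (by positivity) (by norm_num)]
    nlinarith
  set Bβ := B + β • (1 : Matrix n n ℂ) with hBβ
  have hBβp : Bβ.PosDef := Matrix.PosDef.posSemidef_add hBp (Matrix.PosDef.one.smul hβ)
  have hBi := hBβp.inv
  have hBi1 : Bβ⁻¹ * Bβ = 1 :=
    Matrix.nonsing_inv_mul _ ((Matrix.isUnit_iff_isUnit_det _).mp hBβp.isUnit)
  set c₁ := (Bβ⁻¹ * (S * ω + ω * S)).trace.re with hc₁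
  set c₂ := (Bβ⁻¹ * ω).trace.re with hc₂
  -- `η` is chosen after `β`, because `c₁` and `c₂` contain the inverse of `B + β`.
  obtain ⟨η, hη, hηc⟩ : ∃ η : ℝ, 0 < η ∧ η * c₁ + η ^ 2 * c₂ ≤ δ / 2 := by
    have hD : 0 < |c₁| + |c₂| + 1 := by positivity
    refine ⟨min 1 (δ / 2 / (|c₁| + |c₂| + 1)), lt_min one_pos (by positivity), ?_⟩
    set η := min 1 (δ / 2 / (|c₁| + |c₂| + 1))
    have h0 : 0 < η := lt_min one_pos (by positivity)
    have h1 : η ≤ 1 := min_le_left _ _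
    have h2 : η * (|c₁| + |c₂| + 1) ≤ δ / 2 := by
      rw [← le_div_iff₀ hD]; exact min_le_right _ _
    have h3 : η * c₁ ≤ η * |c₁| := mul_le_mul_of_nonneg_left (le_abs_self _) h0.le
    have h4 : η ^ 2 * c₂ ≤ η * |c₂| := by
      calc η ^ 2 * c₂ ≤ η ^ 2 * |c₂| := mul_le_mul_of_nonneg_left (le_abs_self _) (by positivity)
        _ ≤ η * |c₂| := mul_le_mul_of_nonneg_right (by nlinarith) (abs_nonneg _)
    nlinarith
  set Sη := S + η • (1 : Matrix n n ℂ) with hSη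
  have hSηp : Sη.PosDef := Matrix.PosDef.posSemidef_add hSp (Matrix.PosDef.one.smul hη)
  have hSi := hSηp.inv
  have hu := (Matrix.isUnit_iff_isUnit_det _).mp hSηp.isUnit
  have hSi1 : Sη⁻¹ * Sη = 1 := Matrix.nonsing_inv_mul _ hu
  have hSi2 : Sη * Sη⁻¹ = 1 := Matrix.mul_nonsing_inv _ hu
  set Q := Sη⁻¹ * Bβ * Sη⁻¹ with hQ
  set P := Sη * Bβ⁻¹ * Sη with hP
  have hQp : Q.PosDef := by
    have := (Matrix.IsUnit.posDef_star_right_conjugate_iff hSi.isUnit (x := Bβ)).mpr hBβp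
    rwa [Matrix.star_eq_conjTranspose, hSi.1.eq] at this
  have hPQ : P * Q = 1 := by
    calc P * Q = Sη * Bβ⁻¹ * (Sη * Sη⁻¹) * Bβ * Sη⁻¹ := by rw [hP, hQ]; noncomm_ring
      _ = Sη * (Bβ⁻¹ * Bβ) * Sη⁻¹ := by rw [hSi2]; noncomm_ring
      _ = 1 := by rw [hBi1, Matrix.mul_one, hSi2]
  refine ⟨P, Q, ?_, ?_⟩
  · have := hQp.isUnit.invertible
    have h1 := Matrix.PosDef.fromBlocks₂₂ P (1 : Matrix n n ℂ) hQp
    rw [Matrix.conjTranspose_one] at h1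
    rw [h1, Matrix.inv_eq_left_inv hPQ]
    simp [Matrix.PosSemidef.zero]
  · have hXQ : (X * Q).trace.re ≤ B.trace.re + β * N := by
      set C := Sη⁻¹ * X * Sη⁻¹ with hC
      have h1 : (1 - C).PosSemidef := by
        have h2 : ((2 * η) • S + (η * η) • (1 : Matrix n n ℂ)).PosSemidef :=
          (hSp.smul (by positivity)).add (Matrix.PosSemidef.one.smul (by positivity))
        have h3 := h2.mul_mul_conjTranspose_same Sη⁻¹
        rw [hSi.1.eq] at h3
        convert h3 using 1
        have h4 : (2 * η) • S + (η * η) • (1 : Matrix n n ℂ) = Sη * Sη - X := by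
          rw [hSη, ← hSS]
          simp only [Matrix.mul_add, Matrix.add_mul, Matrix.smul_mul, Matrix.mul_smul,
            Matrix.mul_one, Matrix.one_mul, smul_smul, smul_add, two_mul, add_smul]
          abel
        rw [h4, hC]
        calc _ = (Sη⁻¹ * Sη) * (Sη * Sη⁻¹) - Sη⁻¹ * X * Sη⁻¹ := by
              rw [hSi1, hSi2, Matrix.one_mul]
          _ = _ := by noncomm_ring
      have h2 := trace_mul_re_nonneg hBβp.posSemidef h1
      have h3 : (X * Q).trace = (Bβ * C).trace := by
        rw [hQ, hC, ← Matrix.mul_assoc, Matrix.trace_mul_comm]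
        simp only [← Matrix.mul_assoc]
        rw [Matrix.trace_mul_comm]
        simp only [← Matrix.mul_assoc]
      have h4 : Bβ.trace.re = B.trace.re + β * N := by
        rw [hBβ, Matrix.trace_add, Matrix.trace_smul, Matrix.trace_one, Complex.add_re,
          Complex.smul_re, Complex.natCast_re, smul_eq_mul, hN]
      rw [Matrix.mul_sub, Matrix.mul_one, Matrix.trace_sub, Complex.sub_re] at h2
      rw [h3]; linarith
    have hωP : (ω * P).trace.re ≤ B.trace.re + (η * c₁ + η ^ 2 * c₂) := by
      have h1 : (ω * P).trace = (Bβ⁻¹ * (Sη * ω * Sη)).trace := by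
        rw [hP, ← Matrix.mul_assoc, Matrix.trace_mul_comm]
        simp only [← Matrix.mul_assoc]
        rw [Matrix.trace_mul_comm]
        simp only [← Matrix.mul_assoc]
      have h2 : Bβ⁻¹ * (Sη * ω * Sη) = B - β • (Bβ⁻¹ * B) + η • (Bβ⁻¹ * (S * ω + ω * S)) +
          (η * η) • (Bβ⁻¹ * ω) := by
        have h3 : Sη * ω * Sη = Bβ * B - β • B + η • (S * ω + ω * S) + (η * η) • ω := by
          have : Bβ * B - β • B = S * ω * S := by
            rw [← hBB, hBβ, Matrix.add_mul, Matrix.smul_mul, Matrix.one_mul, add_sub_cancel_right]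
          rw [this, hSη]
          simp only [Matrix.mul_add, Matrix.add_mul, Matrix.smul_mul, Matrix.mul_smul,
            Matrix.mul_one, Matrix.one_mul, smul_smul, smul_add]
          abel
        rw [h3]
        simp only [Matrix.mul_add, Matrix.mul_sub, Matrix.mul_smul]
        rw [← Matrix.mul_assoc, hBi1, Matrix.one_mul]
      have h4 := trace_mul_re_nonneg hBi.posSemidef hBp
      rw [h1, h2]
      simp only [Matrix.trace_add, Matrix.trace_sub, Matrix.trace_smul, Complex.add_re,
        Complex.sub_re, Complex.smul_re, smul_eq_mul, ← hc₂]
      rw [← hc₁]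
      nlinarith
    rw [hF]; linarith

theorem isClosed_posSemidef : IsClosed {A : Matrix n n ℂ | A.PosSemidef} := by
  have : {A : Matrix n n ℂ | A.PosSemidef} =
      {A | Aᴴ = A} ∩ ⋂ x : n → ℂ, {A | 0 ≤ star x ⬝ᵥ A *ᵥ x} := by
    ext A
    simp only [Set.mem_ofPred_eq, Matrix.posSemidef_iff_dotProduct_mulVec, Set.mem_inter_iff,
      Set.mem_iInter]
    rfl
  rw [this]
  refine (isClosed_eq (by fun_prop) (by fun_prop)).inter (isClosed_iInter fun x => ?_)
  refine isClosed_le continuous_const ?_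
  fun_prop

/-- An entry is the trace of `σ` against a matrix unit, which is a contraction. -/
theorem norm_apply_le_trace {σ : Matrix n n ℂ} (hσ : σ.PosSemidef) (i j : n) :
    ‖σ i j‖ ≤ σ.trace.re := by
  have hE : IsContraction (Matrix.single j i (1 : ℂ)) := by
    unfold IsContraction
    rw [Matrix.conjTranspose_single, Matrix.single_mul_single_same, star_one, one_mul,
      ← Matrix.diagonal_single, ← Matrix.diagonal_one, Matrix.diagonal_sub]
    refine Matrix.PosSemidef.diagonal fun k => ?_
    by_cases h : k = i
    · subst h; simp
    · simp [h]
  have := norm_trace_mul_le hσ hE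
  rw [Matrix.trace_mul_single] at this
  simpa using this

theorem isCompact_subnormalized : IsCompact {σ : Matrix c c ℂ | IsSubnormalized σ} := by
  have h1 : IsCompact (Set.pi Set.univ fun _ : c => Set.pi Set.univ fun _ : c =>
      Metric.closedBall (0 : ℂ) 1) :=
    isCompact_univ_pi fun _ => isCompact_univ_pi fun _ => isCompact_closedBall _ _
  refine IsCompact.of_isClosed_subset h1 ?_ ?_
  · exact isClosed_posSemidef.inter
      (isClosed_le (Complex.continuous_re.comp (continuous_id.matrix_trace)) continuous_const)
  · intro σ hσ i _ j _
    rw [mem_closedBall_zero_iff]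
    exact (norm_apply_le_trace hσ.1 i j).trans hσ.2

theorem convex_subnormalized : Convex ℝ {σ : Matrix c c ℂ | IsSubnormalized σ} := by
  intro x hx y hy p q hp hq hpq
  refine ⟨(hx.1.smul hp).add (hy.1.smul hq), ?_⟩
  rw [Matrix.trace_add, Matrix.trace_smul, Matrix.trace_smul, Complex.add_re, Complex.smul_re,
    Complex.smul_re, smul_eq_mul, smul_eq_mul]
  nlinarith [hx.2, hy.2]

theorem continuous_traceFst :
    Continuous (traceFst : Matrix (b × c) (b × c) ℂ → Matrix c c ℂ) := by
  unfold traceFst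
  refine continuous_matrix fun i j => ?_
  simp only [Matrix.of_apply]
  fun_prop

/-- Minimax duality for the fidelity with `1 ⊗ σ`. -/
theorem exists_dual_pair {ω : Matrix (b × c) (b × c) ℂ} (hω : ω.PosSemidef) {g g' : ℝ}
    (hg : ∀ σ : Matrix c c ℂ, IsSubnormalized σ → fidelity ω ((1 : Matrix b b ℂ) ⊗ₖ σ) ≤ g)
    (hgg' : g < g') :
    ∃ P Q : Matrix (b × c) (b × c) ℂ, (Matrix.fromBlocks P 1 1 Q).PosSemidef ∧
      ∀ σ : Matrix c c ℂ, IsSubnormalized σ →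
        (ω * P).trace.re + (((1 : Matrix b b ℂ) ⊗ₖ σ) * Q).trace.re ≤ 2 * g' := by
  set X := {σ : Matrix c c ℂ | IsSubnormalized σ} with hX
  set Y := {p : Matrix (b × c) (b × c) ℂ × Matrix (b × c) (b × c) ℂ |
    (Matrix.fromBlocks p.1 1 1 p.2).PosSemidef} with hY
  -- The pairing is affine in each variable. The sign puts the compact set of `σ` on the minimizing
  -- side of Sion's theorem, so that the conclusion is a single pair valid for all `σ`.
  set f : Matrix c c ℂ → Matrix (b × c) (b × c) ℂ × Matrix (b × c) (b × c) ℂ → ℝ :=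
    fun σ p => -((ω * p.1).trace.re + (σ * traceFst p.2).trace.re) with hf
  have hXne : X.Nonempty := ⟨0, Matrix.PosSemidef.zero, by simp⟩
  have cX : Convex ℝ X := convex_subnormalized
  have kX : IsCompact X := isCompact_subnormalized
  have cY : Convex ℝ Y := by
    intro x hx y hy p q hp hq hpq
    have := (hx.smul hp).add (hy.smul hq)
    simp only [Matrix.fromBlocks_smul, Matrix.fromBlocks_add, ← add_smul, hpq, one_smul] at this
    exact this
  have hfx : ∀ y, Continuous fun x => f x y := by
    intro y
    simp only [hf]
    exact (continuous_const.add (Complex.continuous_re.comp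
      ((continuous_id.matrix_mul continuous_const).matrix_trace))).neg
  have hfy : ∀ x, Continuous fun y => f x y := by
    intro x
    simp only [hf]
    exact ((Complex.continuous_re.comp
      ((continuous_const.matrix_mul continuous_fst).matrix_trace)).add (Complex.continuous_re.comp
      ((continuous_const.matrix_mul
        (continuous_traceFst.comp continuous_snd)).matrix_trace))).neg
  have hcx : ∀ y, ∀ p q : ℝ, p + q = 1 → ∀ x x', f (p • x + q • x') y = p * f x y + q * f x' y := by
    intro y p q hpq x x'
    simp only [hf, Matrix.add_mul, Matrix.smul_mul, Matrix.trace_add, Matrix.trace_smul,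
      Complex.add_re, Complex.smul_re, smul_eq_mul]
    have : q = 1 - p := by linarith
    subst this; ring
  have htr : ∀ (p q : ℝ) (A B : Matrix (b × c) (b × c) ℂ),
      traceFst (p • A + q • B) = p • traceFst A + q • traceFst B := by
    intro p q A B
    ext i j
    simp [traceFst, Finset.sum_add_distrib, Finset.mul_sum]
  have hcy : ∀ x, ∀ p q : ℝ, ∀ y y', f x (p • y + q • y') = p * f x y + q * f x y' := by
    intro x p q y y'
    simp only [hf, Prod.fst_add, Prod.snd_add, Prod.smul_fst, Prod.smul_snd, htr, Matrix.mul_add,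
      Matrix.mul_smul, Matrix.trace_add, Matrix.trace_smul, Complex.add_re, Complex.smul_re,
      smul_eq_mul]
    ring
  have hex : ∀ x ∈ X, ∃ y ∈ Y, -(2 * g') < f x y := by
    intro x hx
    obtain ⟨P, Q, hPQ, h⟩ := exists_variational hω
      (Matrix.PosSemidef.one.kronecker hx.1 : ((1 : Matrix b b ℂ) ⊗ₖ x).PosSemidef)
      (sub_pos.mpr hgg')
    refine ⟨(P, Q), hPQ, ?_⟩
    have h1 := hg x hx
    rw [trace_kronecker_one_mul] at h
    simp only [hf]
    linarith
  choose! y hyY hy using hex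
  -- By compactness finitely many pairs already serve all `σ`; the minimax theorem replaces them by
  -- one.
  obtain ⟨s, hsX, hs⟩ := kX.elim_nhds_subcover (fun x => {x' | -(2 * g') < f x' (y x)})
    fun x hx => (isOpen_lt continuous_const (hfx (y x))).mem_nhds (hy x hx)
  obtain ⟨y0, hy0, h⟩ := Sion.exists_lt_iInf_of_lt_iInf_of_finite (f := f) (Y := Y) hXne kX
    (fun y _ => (hfx y).lowerSemicontinuous.lowerSemicontinuousOn _)
    (fun y _ => ConvexOn.quasiconvexOn ⟨cX, fun x _ x' _ p q _ _ hpq =>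
      (hcx y p q hpq x x').le⟩) cY
    (fun x _ => (hfy x).upperSemicontinuous.upperSemicontinuousOn _)
    (fun x _ => ConcaveOn.quasiconcaveOn ⟨cY, fun y _ y' _ p q _ _ _ =>
      (hcy x p q y y').ge⟩) cX (s := y '' s) (s.finite_toSet.image y)
    (by rintro _ ⟨x, hx, rfl⟩; exact hyY x (hsX x hx)) (t := -(2 * g'))
    (fun x hx => by
      obtain ⟨z, hz, hz'⟩ := Set.mem_iUnion₂.mp (hs hx)
      exact ⟨y z, ⟨z, hz, rfl⟩, hz'⟩)
  refine ⟨y0.1, y0.2, hy0, fun σ hσ => ?_⟩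
  have := h σ hσ
  simp only [hf] at this
  rw [trace_kronecker_one_mul]
  linarith

end Minimax

/-! ### Tests built from dual pairs, and smoothing for the min-entropy inequality. -/

section ChainRule

variable {a b c n : Type*} [Fintype a] [DecidableEq a] [Fintype b] [DecidableEq b] [Fintype c]
  [DecidableEq c] [Fintype n] [DecidableEq n]

theorem posSemidef_sub_inv_of_fromBlocks {P Q : Matrix n n ℂ}
    (h : (Matrix.fromBlocks P 1 1 Q).PosSemidef) {t : ℝ} (ht : 0 < t) :
    (P - (Q + t • (1 : Matrix n n ℂ))⁻¹).PosSemidef := by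
  have hQ : Q.PosSemidef := h.submatrix Sum.inr
  set R := Q + t • (1 : Matrix n n ℂ) with hR
  have hRp : R.PosDef := Matrix.PosDef.posSemidef_add hQ (Matrix.PosDef.one.smul ht)
  have hRi := hRp.inv
  have hi : R⁻¹ * R = 1 :=
    Matrix.nonsing_inv_mul _ ((Matrix.isUnit_iff_isUnit_det _).mp hRp.isUnit)
  -- Compressing the block matrix by `(1, -R⁻¹)` gives `P - 2R⁻¹ + R⁻¹ Q R⁻¹ = P - R⁻¹ - t R⁻² ≥ 0`.
  have h1 := h.mul_mul_conjTranspose_same (Matrix.fromCols (1 : Matrix n n ℂ) (-R⁻¹))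
  have h2 := (Matrix.PosSemidef.one (n := n) (R := ℂ)).mul_mul_conjTranspose_same R⁻¹
  rw [hRi.1.eq] at h2
  rw [Matrix.conjTranspose_fromCols_eq_fromRows_conjTranspose, Matrix.fromCols_mul_fromBlocks,
    Matrix.fromCols_mul_fromRows, Matrix.conjTranspose_neg, hRi.1.eq, Matrix.conjTranspose_one]
    at h1
  convert h1.add (h2.smul ht.le) using 1
  have hQR : Q = R - t • (1 : Matrix n n ℂ) := by rw [hR, add_sub_cancel_right]
  have h3 : R⁻¹ * Q * R⁻¹ = R⁻¹ - t • (R⁻¹ * R⁻¹) := by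
    rw [hQR, Matrix.mul_sub, hi, Matrix.sub_mul, Matrix.one_mul, Matrix.mul_smul, Matrix.mul_one,
      Matrix.smul_mul]
  simp only [Matrix.one_mul, Matrix.mul_one, Matrix.neg_mul, Matrix.mul_neg, Matrix.add_mul, h3]
  abel

/-- A test operator of almost full weight whose size is controlled by the fidelities of `ω` with
operators of the form `1 ⊗ σ`. -/
theorem exists_test_of_fidelity_le {ω : Matrix (b × c) (b × c) ℂ} (hω : ω.PosSemidef)
    {g g' κ : ℝ}
    (hg : ∀ σ : Matrix c c ℂ, IsSubnormalized σ → fidelity ω ((1 : Matrix b b ℂ) ⊗ₖ σ) ≤ g)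
    (hgg' : g < g') (hκ : 0 < κ) :
    ∃ T : Matrix (b × c) (b × c) ℂ, T.PosSemidef ∧ (1 - T).PosSemidef ∧
      ω.trace.re - κ ≤ (T * ω).trace.re ∧
      ∀ σ : Matrix c c ℂ, IsSubnormalized σ →
        (T * ((1 : Matrix b b ℂ) ⊗ₖ σ) * T).trace.re ≤ g' ^ 2 / κ := by
  -- The midpoint leaves the gap `g' - g`, which is added to `p` to form a strictly positive `p'`
  -- with `tr XQ ≤ 2g' - p'`. Then `t = κ / p'` makes sense even when `p = 0`.
  obtain ⟨P, Q, hPQ, h⟩ := exists_dual_pair hω hg (g' := (g + g') / 2) (by linarith)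
  have hP : P.PosSemidef := hPQ.submatrix Sum.inl
  have hQ : Q.PosSemidef := hPQ.submatrix Sum.inr
  set p := (ω * P).trace.re with hp
  have hp0 : 0 ≤ p := trace_mul_re_nonneg hω hP
  set p' := p + (g' - g) with hp'
  have hp'0 : 0 < p' := by linarith
  set t := κ / p' with ht
  have ht0 : 0 < t := div_pos hκ hp'0
  set R := Q + t • (1 : Matrix (b × c) (b × c) ℂ) with hR
  have hRp : R.PosDef := Matrix.PosDef.posSemidef_add hQ (Matrix.PosDef.one.smul ht0)
  have hRi := hRp.inv
  have hu := (Matrix.isUnit_iff_isUnit_det _).mp hRp.isUnit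
  have hi : R⁻¹ * R = 1 := Matrix.nonsing_inv_mul _ hu
  have hi' : R * R⁻¹ = 1 := Matrix.mul_nonsing_inv _ hu
  set T := 1 - t • R⁻¹ with hT
  have hTQ : T = Q * R⁻¹ := by
    have : Q = R - t • (1 : Matrix (b × c) (b × c) ℂ) := by rw [hR, add_sub_cancel_right]
    rw [this, Matrix.sub_mul, hi', Matrix.smul_mul, Matrix.one_mul]
  have h1T : (1 - T).PosSemidef := by
    rw [hT, sub_sub_cancel]
    exact hRi.posSemidef.smul ht0.le
  have hTH : Tᴴ = T := by
    have := h1T.1.eq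
    rw [Matrix.conjTranspose_sub, Matrix.conjTranspose_one] at this
    exact sub_right_injective this
  have hQT : Q - t • T = T * R * T := by
    have e1 : T * R = Q := by
      have : Q = R - t • (1 : Matrix (b × c) (b × c) ℂ) := by rw [hR, add_sub_cancel_right]
      rw [hT, Matrix.sub_mul, Matrix.smul_mul, hi, Matrix.one_mul, ← this]
    rw [e1]
    conv_rhs => rw [hT, Matrix.mul_sub, Matrix.mul_one, Matrix.mul_smul, ← hTQ]
  have hTp : T.PosSemidef := by
    have h1 : (R - ((((Real.sqrt t : ℝ) : ℂ) • (1 : Matrix (b × c) (b × c) ℂ)) *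
        (((Real.sqrt t : ℝ) : ℂ) • (1 : Matrix (b × c) (b × c) ℂ))ᴴ)).PosSemidef := by
      convert hQ using 1
      rw [Matrix.conjTranspose_smul, Matrix.conjTranspose_one, Matrix.smul_mul, Matrix.one_mul,
        smul_smul]
      simp only [RCLike.star_def, Complex.conj_ofReal]
      rw [← Complex.ofReal_mul, Real.mul_self_sqrt ht0.le, Complex.coe_smul, hR,
        add_sub_cancel_right]
    have h2 := schur_le_one hRp h1
    convert h2 using 1
    rw [hT, Matrix.conjTranspose_smul, Matrix.conjTranspose_one, Matrix.smul_mul,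
      Matrix.one_mul, Matrix.smul_mul, Matrix.mul_smul, Matrix.mul_one, smul_smul]
    simp only [RCLike.star_def, Complex.conj_ofReal]
    rw [← Complex.ofReal_mul, Real.mul_self_sqrt ht0.le, Complex.coe_smul]
  refine ⟨T, hTp, h1T, ?_, fun σ hσ => ?_⟩
  · have h1 := trace_mul_re_nonneg hω (posSemidef_sub_inv_of_fromBlocks hPQ ht0)
    rw [Matrix.mul_sub, Matrix.trace_sub, Complex.sub_re] at h1
    have h2 : (T * ω).trace.re = ω.trace.re - t * (ω * R⁻¹).trace.re := by
      rw [hT, Matrix.sub_mul, Matrix.one_mul, Matrix.smul_mul, Matrix.trace_sub,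
        Matrix.trace_smul, Complex.sub_re, Complex.smul_re, smul_eq_mul, Matrix.trace_mul_comm]
    have h3 : t * (ω * R⁻¹).trace.re ≤ κ := by
      calc t * (ω * R⁻¹).trace.re ≤ t * p' := by
            apply mul_le_mul_of_nonneg_left _ ht0.le; linarith
        _ = κ := by rw [ht, div_mul_cancel₀ _ hp'0.ne']
    linarith
  · set X := (1 : Matrix b b ℂ) ⊗ₖ σ with hX
    have hXp : X.PosSemidef := Matrix.PosSemidef.one.kronecker hσ.1
    have h1 := trace_mul_re_nonneg hXp (posSemidef_sub_mul_self hTp h1T)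
    have h2 : 0 ≤ (X * (Q - t • T)).trace.re := by
      refine trace_mul_re_nonneg hXp ?_
      rw [hQT]
      have := hRp.posSemidef.mul_mul_conjTranspose_same T
      rwa [hTH] at this
    have h3 := h σ hσ
    rw [Matrix.mul_sub, Matrix.trace_sub, Complex.sub_re] at h1 h2
    rw [Matrix.mul_smul, Matrix.trace_smul, Complex.smul_re, smul_eq_mul] at h2
    have h4 : (T * X * T).trace = (X * (T * T)).trace := by
      rw [Matrix.mul_assoc, Matrix.trace_mul_comm, Matrix.mul_assoc]
    rw [h4, le_div_iff₀ hκ]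
    have h5 : κ = t * p' := by rw [ht, div_mul_cancel₀ _ hp'0.ne']
    -- `t T² ≤ t T ≤ Q`. Multiplying by `p'` and using `p' (2g' - p') ≤ g'²` removes the unknown
    -- `p'` from the final bound.
    have h6 : t * (X * (T * T)).trace.re ≤ 2 * g' - p' := by
      have : t * (X * (T * T)).trace.re ≤ t * (X * T).trace.re :=
        mul_le_mul_of_nonneg_left (by linarith) ht0.le
      linarith
    calc (X * (T * T)).trace.re * κ = p' * (t * (X * (T * T)).trace.re) := by rw [h5]; ring
      _ ≤ p' * (2 * g' - p') := mul_le_mul_of_nonneg_left h6 hp'0.le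
      _ ≤ g' ^ 2 := by nlinarith [sq_nonneg (g' - p')]

theorem pureDist_self {E : Type*} [NormedAddCommGroup E] [InnerProductSpace ℂ E] {x : E}
    (hx : ‖x‖ ≤ 1) : pureDist x x = 0 := by
  have h0 : 0 ≤ 1 - ‖x‖ ^ 2 := by nlinarith [norm_nonneg x]
  have : pureFidelity x x = 1 := by
    rw [pureFidelity, Real.sqrt_mul_self h0, inner_self_eq_norm_sq_to_K]
    simp
  simp [pureDist, this]

/-- The distance between a state and its image under a test on the second subsystem, compared with
the effect of the test on an operator close to the marginal. -/
theorem purifiedDist_test_le {ρ : Matrix (a × n) (a × n) ℂ} {ω T : Matrix n n ℂ} {ε : ℝ}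
    (hρ : IsSubnormalized ρ) (hω : IsSubnormalized ω) (hT : T.PosSemidef)
    (hT1 : (1 - T).PosSemidef) (hε : 0 ≤ ε) (hε1 : ε ≤ 1)
    (h : ω.trace.re - (1 - Real.sqrt (1 - ε ^ 2)) ≤ (T * ω).trace.re) :
    purifiedDist ρ (((1 : Matrix a a ℂ) ⊗ₖ T) * ρ * ((1 : Matrix a a ℂ) ⊗ₖ T)ᴴ) ≤
      ε + 2 * purifiedDist ω (traceFst ρ) := by
  have hTc := isContraction_of_posSemidef hT hT1
  have hρn := hρ.traceFst
  obtain ⟨N, rfl, hN⟩ := exists_purification_pureDist hω.1 hρn.1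
  set R := Matrix.fromCols (CFC.sqrt (traceFst ρ)) (0 : Matrix n n ℂ) with hRdef
  have hR : R * Rᴴ = traceFst ρ := fromCols_sqrt_mul hρn.1
  have hR1 : ‖vec Rᴴ‖ ≤ 1 := by
    rw [norm_vec_conjTranspose]; exact norm_vec_le_one (by rw [hR]; exact hρn.2)
  have hN1 : ‖vec Nᴴ‖ ≤ 1 := by
    rw [norm_vec_conjTranspose]; exact norm_vec_le_one hω.2
  -- Adjoints are taken because the chain applies the test on the right. Here the tested vector is
  -- the reference vector `Rᴴ` itself, so the `M`-term vanishes.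
  have h1 := pureDist_chain hR1 hR1 hN1 hTc hε hε1 (by
    rw [norm_vec_conjTranspose, norm_vec_sq]
    refine (h.trans (re_le_norm_trace _)).trans (le_of_eq ?_)
    rw [Matrix.conjTranspose_mul, Matrix.conjTranspose_conjTranspose, hT.1.eq,
      Matrix.mul_assoc])
  rw [pureDist_self hR1, add_zero, pureDist_conjTranspose, hN] at h1
  refine le_trans ?_ h1
  set S := CFC.sqrt ρ
  have hSS : S * Sᴴ = ρ := sqrt_mul_conjTranspose hρ.1
  set T' := (1 : Matrix a a ℂ) ⊗ₖ T with hT'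
  have hTT : T'ᴴ = T' := by rw [hT', Matrix.conjTranspose_kronecker, hT.1.eq, Matrix.conjTranspose_one]
  have h2 := purifiedDist_le_pureDist S (T' * S)
  have e1 : (T' * S) * (T' * S)ᴴ = T' * ρ * T'ᴴ := by
    rw [← hSS, Matrix.conjTranspose_mul]; simp only [Matrix.mul_assoc]
  rw [hSS, e1] at h2
  refine h2.trans (le_of_eq ?_)
  -- The norms and the overlap of `S` and `(1 ⊗ T) S` depend only on `tr_A ρ`, so they agree with
  -- those of `Rᴴ` and `Rᴴ T`.
  have n1 : ‖vec S‖ ^ 2 = ‖vec Rᴴ‖ ^ 2 := by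
    rw [norm_vec_conjTranspose, norm_vec_sq, norm_vec_sq, hSS, hR, trace_traceFst]
  have n2 : ‖vec (T' * S)‖ ^ 2 = ‖vec (Rᴴ * T)‖ ^ 2 := by
    rw [← norm_vec_conjTranspose (Rᴴ * T), norm_vec_sq, norm_vec_sq, e1, Matrix.trace_mul_comm,
      ← Matrix.mul_assoc, hTT, hT', ← Matrix.mul_kronecker_mul, Matrix.mul_one,
      trace_kronecker_one_mul, ← hR]
    simp only [Matrix.conjTranspose_mul, Matrix.conjTranspose_conjTranspose, hT.1.eq]
    rw [Matrix.mul_assoc T T, Matrix.trace_mul_comm T]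
    simp only [Matrix.mul_assoc]
  have n3 : ‖(inner ℂ (vec S) (vec (T' * S)) : ℂ)‖ = ‖(inner ℂ (vec (Rᴴ * T)) (vec Rᴴ) : ℂ)‖ := by
    rw [inner_vec, inner_vec, Matrix.conjTranspose_mul, Matrix.conjTranspose_conjTranspose,
      hT.1.eq, Matrix.trace_mul_comm, Matrix.mul_assoc, hSS, hT', trace_kronecker_one_mul, ← hR,
      Matrix.mul_assoc]
  rw [pureDist, pureDist, pureFidelity, pureFidelity, n1, n2, n3, mul_comm]

/-- From an operator `ω` close to the marginal of `ρ` with small fidelities, a smoothing of `τ`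
bounded by a multiple of `1 ⊗ σ'`. -/
theorem exists_smoothing_le {ρ τ : Matrix (a × b × c) (a × b × c) ℂ}
    {ω : Matrix (b × c) (b × c) ℂ} {σ : Matrix c c ℂ} {s g g' ε : ℝ}
    (hρ : IsSubnormalized ρ) (hτ : IsSubnormalized τ) (hω : IsSubnormalized ω)
    (hσ : IsSubnormalized σ) (hε : 0 < ε) (hε1 : ε < 1)
    (h : (s • ((1 : Matrix a a ℂ) ⊗ₖ ((1 : Matrix b b ℂ) ⊗ₖ σ)) - τ).PosSemidef)
    (hg : ∀ σ : Matrix c c ℂ, IsSubnormalized σ → fidelity ω ((1 : Matrix b b ℂ) ⊗ₖ σ) ≤ g)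
    (hgg' : g < g') :
    ∃ ν : Matrix (a × b × c) (a × b × c) ℂ, IsSubnormalized ν ∧
      purifiedDist ν ρ ≤ ε + purifiedDist τ ρ + 2 * purifiedDist ω (traceFst ρ) ∧
      ∃ σ' : Matrix (b × c) (b × c) ℂ, IsSubnormalized σ' ∧
        ((s * (g' ^ 2 / (1 - Real.sqrt (1 - ε ^ 2)))) • ((1 : Matrix a a ℂ) ⊗ₖ σ') -
          ν).PosSemidef := by
  have hq1 : Real.sqrt (1 - ε ^ 2) < 1 := by
    rw [Real.sqrt_lt' one_pos]; nlinarith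
  set κ := 1 - Real.sqrt (1 - ε ^ 2) with hκdef
  have hκ : 0 < κ := by linarith
  have hg' : 0 < g' := by
    have := hg 0 ⟨Matrix.PosSemidef.zero, by simp⟩
    linarith [fidelity_nonneg ω ((1 : Matrix b b ℂ) ⊗ₖ (0 : Matrix c c ℂ))]
  obtain ⟨T, hT, hT1, hTω, hTσ⟩ := exists_test_of_fidelity_le hω.1 hg hgg' hκ
  set T' := (1 : Matrix a a ℂ) ⊗ₖ T with hT'
  have hTc : IsContraction T' := by
    unfold IsContraction
    have h1 : ((1 : Matrix a a ℂ) ⊗ₖ (1 - Tᴴ * T)).PosSemidef :=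
      Matrix.PosSemidef.one.kronecker (isContraction_of_posSemidef hT hT1)
    convert h1 using 1
    rw [hT', Matrix.conjTranspose_kronecker, ← Matrix.mul_kronecker_mul, Matrix.conjTranspose_one,
      Matrix.mul_one, sub_eq_iff_eq_add, ← Matrix.kronecker_add, sub_add_cancel,
      Matrix.one_kronecker_one]
  set G := g' ^ 2 / κ with hG
  have hG0 : 0 < G := by positivity
  set X := (1 : Matrix b b ℂ) ⊗ₖ σ with hX
  have hXp : X.PosSemidef := Matrix.PosSemidef.one.kronecker hσ.1
  refine ⟨T' * τ * T'ᴴ, hτ.conj hTc, ?_, G⁻¹ • (T * X * T), ⟨?_, ?_⟩, ?_⟩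
  · have h1 := purifiedDist_triangle (hτ.conj hTc) (hρ.conj hTc) hρ
    have h2 := purifiedDist_conj_le hTc hτ hρ
    have h3 := purifiedDist_test_le hρ hω hT hT1 hε.le hε1.le hTω
    linarith
  · have := hXp.mul_mul_conjTranspose_same T
    rw [hT.1.eq] at this
    exact this.smul (inv_nonneg.mpr hG0.le)
  · rw [Matrix.trace_smul, Complex.smul_re, smul_eq_mul, inv_mul_le_iff₀ hG0, mul_one]
    exact hTσ σ hσ
  · have h1 := h.mul_mul_conjTranspose_same T'
    convert h1 using 1
    rw [Matrix.mul_sub, Matrix.sub_mul]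
    congr 1
    rw [Matrix.mul_smul, Matrix.smul_mul, hT', Matrix.conjTranspose_kronecker,
      ← Matrix.mul_kronecker_mul, ← Matrix.mul_kronecker_mul, hT.1.eq, Matrix.conjTranspose_one,
      Matrix.one_mul, Matrix.one_mul, Matrix.kronecker_smul, smul_smul, mul_assoc,
      mul_inv_cancel₀ hG0.ne', mul_one]

theorem fidelity_sq_le {ρ σ : Matrix n n ℂ} (hρ : ρ.PosSemidef) (hσ : σ.PosSemidef) :
    fidelity ρ σ ^ 2 ≤ ρ.trace.re * σ.trace.re := by
  obtain ⟨K, hK, h⟩ := exists_trace_eq_fidelity (CFC.sqrt ρ) (CFC.sqrt σ)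
  rw [sqrt_mul_conjTranspose hρ, sqrt_mul_conjTranspose hσ, Matrix.mul_assoc, ← inner_vec] at h
  have h1 := norm_inner_le_norm (𝕜 := ℂ) (vec (CFC.sqrt ρ)) (vec (CFC.sqrt σ * K))
  rw [h, Complex.norm_real, Real.norm_of_nonneg (fidelity_nonneg _ _)] at h1
  have h2 := h1.trans (mul_le_mul_of_nonneg_left (hK.norm_vec_mul_right_le (CFC.sqrt σ))
    (norm_nonneg _))
  have h3 := pow_le_pow_left₀ (fidelity_nonneg ρ σ) h2 2
  rwa [mul_pow, norm_vec_sq, norm_vec_sq, sqrt_mul_conjTranspose hρ,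
    sqrt_mul_conjTranspose hσ] at h3

/-- Crude but dimension-only; applied to `A = √ω`, it turns a lower bound on `tr ω` into one on `tr
√ω`. -/
theorem trace_mul_self_le {A : Matrix n n ℂ} (hA : A.PosSemidef) :
    (A * A).trace.re ≤ (Fintype.card n * A.trace.re) ^ 2 := by
  refine (re_le_norm_trace _).trans ?_
  simp only [Matrix.trace, Matrix.diag, Matrix.mul_apply]
  refine (norm_sum_le _ _).trans ?_
  calc ∑ i, ‖∑ j, A i j * A j i‖ ≤ ∑ _i : n, ∑ _j : n, A.trace.re * A.trace.re := by
        refine Finset.sum_le_sum fun i _ => (norm_sum_le _ _).trans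
          (Finset.sum_le_sum fun j _ => ?_)
        rw [norm_mul]
        exact mul_le_mul (norm_apply_le_trace hA i j) (norm_apply_le_trace hA j i)
          (norm_nonneg _) (trace_re_nonneg hA)
    _ = _ := by
        simp only [Finset.sum_const, Finset.card_univ, nsmul_eq_mul, Matrix.trace, Matrix.diag]
        ring

/-- Operators that stay away from zero in purified distance have trace bounded below. -/
theorem exists_trace_lower_bound {ρ : Matrix n n ℂ} {δ : ℝ} (hρ : IsSubnormalized ρ)
    (hδ : 0 ≤ δ) (h : δ < Real.sqrt ρ.trace.re) :
    ∃ θ : ℝ, 0 < θ ∧ ∀ ω : Matrix n n ℂ, IsSubnormalized ω → purifiedDist ω ρ ≤ δ →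
      θ ≤ ω.trace.re := by
  have hδ2 : δ ^ 2 < ρ.trace.re := (Real.lt_sqrt hδ).mp h
  have hρ1 := hρ.2
  have hlt : Real.sqrt (1 - ρ.trace.re) < Real.sqrt (1 - δ ^ 2) :=
    Real.sqrt_lt_sqrt (by linarith) (by linarith)
  -- In the generalized fidelity, `F(ω, ρ) ≤ √(tr ω)` and the other term is at most `√(1 - tr ρ)`,
  -- while the sum is at least `√(1 - δ²)`.
  refine ⟨(Real.sqrt (1 - δ ^ 2) - Real.sqrt (1 - ρ.trace.re)) ^ 2,
    pow_pos (by linarith) 2, fun ω hω hP => ?_⟩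
  have hω0 := trace_re_nonneg hω.1
  have h1 : 1 - genFidelity ω ρ ^ 2 ≤ δ ^ 2 := (Real.sqrt_le_iff.mp hP).2
  have hgf : 0 ≤ genFidelity ω ρ := add_nonneg (fidelity_nonneg _ _) (Real.sqrt_nonneg _)
  have h2 : Real.sqrt (1 - δ ^ 2) ≤ genFidelity ω ρ :=
    Real.sqrt_le_iff.mpr ⟨hgf, by linarith⟩
  have h3 : fidelity ω ρ ≤ Real.sqrt ω.trace.re := by
    apply Real.le_sqrt_of_sq_le
    refine (fidelity_sq_le hω.1 hρ.1).trans ?_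
    exact mul_le_of_le_one_right hω0 hρ1
  have h4 : Real.sqrt ((1 - ω.trace.re) * (1 - ρ.trace.re)) ≤ Real.sqrt (1 - ρ.trace.re) :=
    Real.sqrt_le_sqrt (mul_le_of_le_one_left (by linarith) (by linarith))
  have h5 : Real.sqrt (1 - δ ^ 2) - Real.sqrt (1 - ρ.trace.re) ≤ Real.sqrt ω.trace.re := by
    unfold genFidelity at h2; linarith
  calc _ ≤ Real.sqrt ω.trace.re ^ 2 := pow_le_pow_left₀ (by linarith) h5 2
    _ = _ := Real.sq_sqrt hω0

end ChainRule

/-! ### Translation to entropies and passage to extended reals. -/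

section Entropies

variable {a b c n : Type*} [Fintype a] [DecidableEq a] [Fintype b] [DecidableEq b] [Fintype c]
  [DecidableEq c] [Fintype n] [DecidableEq n]

theorem log2_le_iff {x : ℝ} (hx : 0 ≤ x) (h : ℝ) : log2 x ≤ (h : EReal) ↔ x ≤ (2 : ℝ) ^ h := by
  unfold log2
  split_ifs with h0
  · subst h0
    simp only [bot_le, true_iff]
    positivity
  · rw [EReal.coe_le_coe_iff, Real.logb_le_iff_le_rpow one_lt_two (lt_of_le_of_ne hx (Ne.symm h0))]

theorem maxEntropy_le_iff {ρ : Matrix (a × b) (a × b) ℂ} {h : ℝ} :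
    maxEntropy ρ ≤ (h : EReal) ↔ ∀ σ : Matrix b b ℂ, IsSubnormalized σ →
      fidelity ρ ((1 : Matrix a a ℂ) ⊗ₖ σ) ^ 2 ≤ (2 : ℝ) ^ h := by
  simp only [maxEntropy, iSup_le_iff, maxEntropyRel, log2_le_iff (sq_nonneg _)]

theorem rpow_half_sq (x : ℝ) : ((2 : ℝ) ^ (x / 2)) ^ 2 = (2 : ℝ) ^ x := by
  rw [← Real.rpow_natCast, ← Real.rpow_mul (by norm_num)]
  norm_num

theorem fidelity_le_of_maxEntropy_le {ρ : Matrix (a × b) (a × b) ℂ} {h : ℝ}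
    (hh : maxEntropy ρ ≤ (h : EReal)) (σ : Matrix b b ℂ) (hσ : IsSubnormalized σ) :
    fidelity ρ ((1 : Matrix a a ℂ) ⊗ₖ σ) ≤ (2 : ℝ) ^ (h / 2) := by
  refine le_of_sq_le_sq ?_ (by positivity)
  rw [rpow_half_sq]
  exact maxEntropy_le_iff.mp hh σ hσ

theorem le_minEntropy {ρ : Matrix (a × b) (a × b) ℂ} {σ : Matrix b b ℂ} {r : ℝ}
    (hσ : IsSubnormalized σ)
    (h : (((2 : ℝ) ^ (-r)) • ((1 : Matrix a a ℂ) ⊗ₖ σ) - ρ).PosSemidef) :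
    (r : EReal) ≤ minEntropy ρ :=
  le_iSup₂_of_le σ hσ (le_iSup₂_of_le (f := fun (r : ℝ) _ => (r : EReal)) r h le_rfl)

theorem isSubnormalized_zero : IsSubnormalized (0 : Matrix n n ℂ) :=
  ⟨Matrix.PosSemidef.zero, by simp⟩

theorem minEntropy_zero : minEntropy (0 : Matrix (a × b) (a × b) ℂ) = ⊤ := by
  rw [EReal.eq_top_iff_forall_lt]
  intro y
  refine lt_of_lt_of_le (EReal.coe_lt_coe_iff.mpr (lt_add_one y))
    (le_minEntropy isSubnormalized_zero ?_)
  simpa using Matrix.PosSemidef.zero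

theorem maxEntropy_zero : maxEntropy (0 : Matrix (a × b) (a × b) ℂ) = ⊥ := by
  rw [eq_bot_iff]
  refine iSup₂_le fun σ hσ => ?_
  have h := fidelity_sq_le (Matrix.PosSemidef.zero : (0 : Matrix (a × b) (a × b) ℂ).PosSemidef)
    (Matrix.PosSemidef.one.kronecker hσ.1 : ((1 : Matrix a a ℂ) ⊗ₖ σ).PosSemidef)
  rw [Matrix.trace_zero, Complex.zero_re, zero_mul] at h
  rw [maxEntropyRel, log2, if_pos (le_antisymm h (sq_nonneg _))]

theorem purifiedDist_le_one (ρ σ : Matrix n n ℂ) : purifiedDist ρ σ ≤ 1 :=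
  Real.sqrt_le_one.mpr (by nlinarith [sq_nonneg (genFidelity ρ σ)])

theorem exists_maxEntropy_le {ρ : Matrix (a × b) (a × b) ℂ} (hρ : IsSubnormalized ρ) :
    ∃ h : ℝ, maxEntropy ρ ≤ (h : EReal) := by
  refine ⟨Fintype.card a, maxEntropy_le_iff.mpr fun σ hσ => ?_⟩
  refine (fidelity_sq_le hρ.1 (Matrix.PosSemidef.one.kronecker hσ.1)).trans ?_
  rw [Matrix.trace_kronecker, Matrix.trace_one, ← Complex.ofReal_natCast, Complex.re_ofReal_mul,
    Real.rpow_natCast]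
  have h1 : ((Fintype.card a : ℕ) : ℝ) ≤ 2 ^ Fintype.card a := by
    exact_mod_cast Nat.lt_two_pow_self.le
  have h2 := trace_re_nonneg hρ.1
  have h3 := trace_re_nonneg hσ.1
  have h4 : ((Fintype.card a : ℕ) : ℝ) * σ.trace.re ≤ Fintype.card a :=
    mul_le_of_le_one_right (Nat.cast_nonneg _) hσ.2
  have h5 : ρ.trace.re * (((Fintype.card a : ℕ) : ℝ) * σ.trace.re) ≤
      ((Fintype.card a : ℕ) : ℝ) * σ.trace.re :=
    mul_le_of_le_one_left (mul_nonneg (Nat.cast_nonneg _) h3) hρ.2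
  linarith

/-- Testing with the maximally mixed `σ₀` bounds every fidelity below by `tr √ω / √|b|`, and the
traces in the ball are uniformly positive. This excludes `⊤ + ⊥ = ⊥` on the right side of the
min-entropy inequality. -/
theorem smoothMaxEntropy_ne_bot {ρ : Matrix (a × b) (a × b) ℂ} {δ : ℝ}
    (hρ : IsSubnormalized ρ) (hδ : 0 ≤ δ) (h : δ < Real.sqrt ρ.trace.re) :
    smoothMaxEntropy δ ρ ≠ ⊥ := by
  obtain ⟨θ, hθ, hθω⟩ := exists_trace_lower_bound hρ hδ h
  have hne : Nonempty (a × b) := by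
    by_contra hcon
    rw [not_nonempty_iff] at hcon
    have : ρ.trace.re = 0 := by simp [Matrix.trace]
    rw [this, Real.sqrt_zero] at h
    linarith
  have hb : Nonempty b := hne.map Prod.snd
  have hB : (0 : ℝ) < Fintype.card b := by exact_mod_cast Fintype.card_pos
  have hN : (0 : ℝ) < Fintype.card (a × b) := by exact_mod_cast Fintype.card_pos
  set s := (Real.sqrt (Fintype.card b))⁻¹ with hs
  have hs0 : 0 < s := inv_pos.mpr (Real.sqrt_pos.mpr hB)
  have hss : s * s = (Fintype.card b : ℝ)⁻¹ := by
    rw [hs, ← mul_inv, Real.mul_self_sqrt hB.le]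
  set x := s ^ 2 * (θ / (Fintype.card (a × b) : ℝ) ^ 2) with hx
  have hx0 : 0 < x := by positivity
  set σ₀ : Matrix b b ℂ := (s * s) • 1 with hσ₀
  have hσ₀s : IsSubnormalized σ₀ := by
    refine ⟨Matrix.PosSemidef.one.smul (mul_pos hs0 hs0).le, ?_⟩
    rw [hσ₀, Matrix.trace_smul, Matrix.trace_one, Complex.smul_re, Complex.natCast_re,
      smul_eq_mul, hss, inv_mul_cancel₀ hB.ne']
  have key : ((Real.logb 2 x : ℝ) : EReal) ≤ smoothMaxEntropy δ ρ := by
    refine le_iInf₂ fun ω hω => le_iSup₂_of_le σ₀ hσ₀s ?_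
    set A := CFC.sqrt ω with hA
    have hAp : A.PosSemidef := sqrt_posSemidef ω
    have hc : IsContraction (1 : Matrix (a × b) (a × b) ℂ) := by
      simp [IsContraction, Matrix.PosSemidef.zero]
    have h1 := norm_trace_le_fidelity A ((s : ℂ) • (1 : Matrix (a × b) (a × b) ℂ)) hc
    have e1 : ((s : ℂ) • (1 : Matrix (a × b) (a × b) ℂ)) *
        ((s : ℂ) • (1 : Matrix (a × b) (a × b) ℂ))ᴴ = (1 : Matrix a a ℂ) ⊗ₖ σ₀ := by
      rw [hσ₀, Matrix.kronecker_smul, Matrix.one_kronecker_one, Matrix.conjTranspose_smul,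
        Matrix.conjTranspose_one, Matrix.smul_mul, Matrix.one_mul, smul_smul]
      simp only [RCLike.star_def, Complex.conj_ofReal]
      rw [← Complex.ofReal_mul, Complex.coe_smul]
    rw [e1, sqrt_mul_conjTranspose hω.1.1, hAp.1.eq, Matrix.mul_one, Matrix.mul_smul,
      Matrix.mul_one] at h1
    have h2 := (re_le_norm_trace _).trans h1
    rw [Matrix.trace_smul, smul_eq_mul, Complex.re_ofReal_mul] at h2
    have h3 := trace_mul_self_le hAp
    rw [hA, sqrt_mul_sqrt hω.1.1, ← hA] at h3
    have h4 := (hθω ω hω.1 hω.2).trans h3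
    have h5 : x ≤ fidelity ω ((1 : Matrix a a ℂ) ⊗ₖ σ₀) ^ 2 := by
      calc x ≤ s ^ 2 * A.trace.re ^ 2 := by
            rw [hx]
            apply mul_le_mul_of_nonneg_left _ (sq_nonneg s)
            rw [div_le_iff₀ (by positivity), mul_comm, ← mul_pow]
            exact h4
        _ = (s * A.trace.re) ^ 2 := by ring
        _ ≤ _ := pow_le_pow_left₀ (mul_nonneg hs0.le (trace_re_nonneg hAp)) h2 2
    rw [maxEntropyRel, log2, if_neg (lt_of_lt_of_le hx0 h5).ne', EReal.coe_le_coe_iff]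
    exact Real.logb_le_logb_of_le one_lt_two hx0 h5
  exact ne_bot_of_le_ne_bot (EReal.coe_ne_bot _) key

theorem two_rpow_errorTerm {ε : ℝ} (hε : 0 < ε) (hε1 : ε < 1) :
    0 < errorTerm ε ∧ (2 : ℝ) ^ errorTerm ε = (1 - Real.sqrt (1 - ε ^ 2))⁻¹ := by
  have hq0 : 0 < Real.sqrt (1 - ε ^ 2) := Real.sqrt_pos.mpr (by nlinarith)
  have hq1 : Real.sqrt (1 - ε ^ 2) < 1 := by
    rw [Real.sqrt_lt' one_pos]; nlinarith
  have hκ : 0 < 1 - Real.sqrt (1 - ε ^ 2) := by linarith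
  unfold errorTerm
  rw [one_div]
  exact ⟨Real.logb_pos one_lt_two ((one_lt_inv₀ hκ).mpr (by linarith)),
    Real.rpow_logb two_pos (by norm_num) (inv_pos.mpr hκ)⟩

theorem assocLeft_one_kronecker (σ : Matrix c c ℂ) :
    assocLeft ((1 : Matrix a a ℂ) ⊗ₖ ((1 : Matrix b b ℂ) ⊗ₖ σ)) =
      (1 : Matrix (a × b) (a × b) ℂ) ⊗ₖ σ := by
  ext ⟨⟨i, j⟩, k⟩ ⟨⟨i', j'⟩, k'⟩
  simp only [assocLeft, Matrix.submatrix_apply, Equiv.prodAssoc_apply, Matrix.kroneckerMap_apply,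
    Matrix.one_apply, Prod.mk.injEq]
  split_ifs <;> simp_all

/-- Every operator on `(A ⊗ B) ⊗ C` comes from one on `A ⊗ (B ⊗ C)`. -/
theorem exists_assocLeft_eq {ρ : Matrix (a × b × c) (a × b × c) ℂ} (hρ : IsSubnormalized ρ)
    {τ : Matrix ((a × b) × c) ((a × b) × c) ℂ} (hτ : IsSubnormalized τ) :
    ∃ τ' : Matrix (a × b × c) (a × b × c) ℂ, IsSubnormalized τ' ∧ assocLeft τ' = τ ∧
      purifiedDist τ' ρ = purifiedDist τ (assocLeft ρ) := by
  set f := Equiv.prodAssoc a b c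
  have h1 : assocLeft (τ.submatrix f.symm f.symm) = τ := by
    simp [assocLeft, Matrix.submatrix_submatrix, f]
  have h2 := hτ.submatrix f.symm
  refine ⟨τ.submatrix f.symm f.symm, h2, h1, ?_⟩
  conv_rhs => rw [← h1]
  exact (purifiedDist_submatrix f h2.1 hρ.1).symm

theorem le_smoothMinEntropy_of_le {ε ε' ε'' r h : ℝ} (hε : 0 < ε) (hε1 : ε < 1)
    {ρ : Matrix (a × b × c) (a × b × c) ℂ} (hρ : IsSubnormalized ρ)
    {τ : Matrix ((a × b) × c) ((a × b) × c) ℂ} (hτ : IsSubnormalized τ)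
    (hτρ : purifiedDist τ (assocLeft ρ) ≤ ε') {σ : Matrix c c ℂ} (hσ : IsSubnormalized σ)
    (hr : τ ≤ ((2 : ℝ) ^ (-r)) • ((1 : Matrix (a × b) (a × b) ℂ) ⊗ₖ σ))
    {ω : Matrix (b × c) (b × c) ℂ} (hω : IsSubnormalized ω)
    (hωρ : purifiedDist ω (traceFst ρ) ≤ ε'') (hh : maxEntropy ω ≤ (h : EReal)) :
    ((r - h - 2 * errorTerm ε : ℝ) : EReal) ≤ smoothMinEntropy (ε + ε' + 2 * ε'') ρ := by
  obtain ⟨hf, hf2⟩ := two_rpow_errorTerm hε hε1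
  obtain ⟨τ', hτ', rfl, hd⟩ := exists_assocLeft_eq hρ hτ
  have hr' : (((2 : ℝ) ^ (-r)) • ((1 : Matrix a a ℂ) ⊗ₖ ((1 : Matrix b b ℂ) ⊗ₖ σ)) -
      τ').PosSemidef := by
    have := Matrix.le_iff.mp hr
    rw [← assocLeft_one_kronecker] at this
    exact (Matrix.posSemidef_submatrix_equiv (Equiv.prodAssoc a b c)).mp this
  obtain ⟨ν, hν, hνρ, σ', hσ', hle⟩ := exists_smoothing_le hρ hτ' hω hσ
    hε hε1 hr' (fidelity_le_of_maxEntropy_le hh)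
    -- The strict gap `g < g'` is bought with one error term, `g'² = 2^(h + f)`; dividing by `κ =
    -- 2^(-f)` uses the second.
    (g' := (2 : ℝ) ^ ((h + errorTerm ε) / 2))
    (Real.rpow_lt_rpow_of_exponent_lt one_lt_two (by linarith))
  refine le_iSup₂_of_le ν ⟨hν, by rw [hd] at hνρ; linarith⟩ (le_minEntropy hσ' ?_)
  have e : (2 : ℝ) ^ (-(r - h - 2 * errorTerm ε)) =
      (2 : ℝ) ^ (-r) * (((2 : ℝ) ^ ((h + errorTerm ε) / 2)) ^ 2 /
        (1 - Real.sqrt (1 - ε ^ 2))) := by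
    rw [div_eq_mul_inv, ← hf2, rpow_half_sq, ← Real.rpow_add two_pos, ← Real.rpow_add two_pos]
    congr 1; ring
  rwa [e]

theorem smoothMaxEntropy_le_of_le {ε ε' ε'' k m : ℝ} (hε : 0 < ε) (hε1 : ε < 1)
    [Nonempty (b × c)]
    {ρ : Matrix (a × b × c) (a × b × c) ℂ} (hρ : IsSubnormalized ρ)
    {τ : Matrix ((a × b) × c) ((a × b) × c) ℂ} (hτ : IsSubnormalized τ)
    (hτρ : purifiedDist τ (assocLeft ρ) ≤ ε') (hm : maxEntropy τ ≤ (m : EReal))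
    {ω : Matrix (a × b × c) (a × b × c) ℂ} (hω : IsSubnormalized ω)
    (hωρ : purifiedDist ω ρ ≤ ε'') {σ : Matrix (b × c) (b × c) ℂ} (hσ : IsSubnormalized σ)
    (hk : ω ≤ ((2 : ℝ) ^ (-k)) • ((1 : Matrix a a ℂ) ⊗ₖ σ)) :
    smoothMaxEntropy (ε + ε' + 2 * ε'') (traceFst ρ) ≤
      ((m - k + 2 * errorTerm ε : ℝ) : EReal) := by
  obtain ⟨hf, hf2⟩ := two_rpow_errorTerm hε hε1
  obtain ⟨τ', hτ', rfl, hd⟩ := exists_assocLeft_eq hρ hτ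
  obtain ⟨ν, hν, hνρ, hF⟩ := exists_smoothing_fidelity_le hρ hτ' hω hσ hε hε1
    (Real.rpow_pos_of_pos two_pos _) (Matrix.le_iff.mp hk)
  refine iInf₂_le_of_le ν ⟨hν, by rw [hd] at hνρ; linarith⟩ (maxEntropy_le_iff.mpr fun χ hχ => ?_)
  set S := (1 : Matrix b b ℂ) ⊗ₖ CFC.sqrt χ with hS
  have hSS : S * Sᴴ = (1 : Matrix b b ℂ) ⊗ₖ χ := by
    rw [hS, Matrix.conjTranspose_kronecker, ← Matrix.mul_kronecker_mul,
      sqrt_mul_conjTranspose hχ.1, Matrix.conjTranspose_one, Matrix.mul_one]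
  have h1 := hF S
  have h2 : ((1 : Matrix a a ℂ) ⊗ₖ S) * ((1 : Matrix a a ℂ) ⊗ₖ S)ᴴ =
      (1 : Matrix a a ℂ) ⊗ₖ ((1 : Matrix b b ℂ) ⊗ₖ χ) := by
    rw [Matrix.conjTranspose_kronecker, ← Matrix.mul_kronecker_mul, hSS, Matrix.conjTranspose_one,
      Matrix.mul_one]
  have hp : ((1 : Matrix a a ℂ) ⊗ₖ ((1 : Matrix b b ℂ) ⊗ₖ χ)).PosSemidef :=
    Matrix.PosSemidef.one.kronecker (Matrix.PosSemidef.one.kronecker hχ.1)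
  have h3 : fidelity τ' ((1 : Matrix a a ℂ) ⊗ₖ ((1 : Matrix b b ℂ) ⊗ₖ χ)) ^ 2 ≤ (2 : ℝ) ^ m := by
    have := maxEntropy_le_iff.mp hm χ hχ
    rw [← assocLeft_one_kronecker] at this
    unfold assocLeft at this
    rwa [fidelity_submatrix _ hτ'.1 hp] at this
  rw [hSS, h2] at h1
  have h4 := pow_le_pow_left₀ (fidelity_nonneg _ _) h1 2
  rw [mul_pow, Real.sq_sqrt (by positivity)] at h4
  refine h4.trans ((mul_le_mul_of_nonneg_left h3 (by positivity)).trans (le_of_eq ?_))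
  rw [div_eq_mul_inv, ← inv_pow, ← hf2, ← Real.rpow_natCast, ← Real.rpow_mul two_pos.le,
    ← Real.rpow_add two_pos, ← Real.rpow_add two_pos]
  congr 1; push_cast; ring

theorem smoothMinEntropy_chain {ε ε' ε'' : ℝ} (hε : 0 < ε) (hε' : 0 ≤ ε') (hε'' : 0 ≤ ε'')
    {ρ : Matrix (a × b × c) (a × b × c) ℂ} (hρ : IsSubnormalized ρ)
    (hρε'' : ε'' < Real.sqrt ρ.trace.re) :
    smoothMinEntropy ε' (assocLeft ρ) ≤
      smoothMinEntropy (ε + ε' + 2 * ε'') ρ + smoothMaxEntropy ε'' (traceFst ρ)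
        + ((2 * errorTerm ε : ℝ) : EReal) := by
  have hB : smoothMaxEntropy ε'' (traceFst ρ) ≠ ⊥ :=
    smoothMaxEntropy_ne_bot hρ.traceFst hε'' (by rwa [trace_traceFst])
  by_cases hε1 : ε < 1
  swap
  -- The purified distance never exceeds 1, so zero, of infinite min-entropy, lies in the ball.
  · have : smoothMinEntropy (ε + ε' + 2 * ε'') ρ = ⊤ := by
      refine top_le_iff.mp (le_iSup₂_of_le 0 ⟨isSubnormalized_zero, ?_⟩ minEntropy_zero.ge)
      exact (purifiedDist_le_one _ _).trans (by linarith)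
    rw [this, EReal.top_add_of_ne_bot hB, EReal.top_add_coe]
    exact le_top
  refine iSup₂_le fun τ hτ => iSup₂_le fun σ hσ => iSup₂_le fun r hr => ?_
  have key : ∀ h : ℝ, smoothMaxEntropy ε'' (traceFst ρ) < (h : EReal) →
      ((r - h - 2 * errorTerm ε : ℝ) : EReal) ≤ smoothMinEntropy (ε + ε' + 2 * ε'') ρ := by
    intro h hh
    simp only [smoothMaxEntropy, iInf_lt_iff] at hh
    obtain ⟨ω, hω, hωh⟩ := hh
    exact le_smoothMinEntropy_of_le hε hε1 hρ hτ.1 hτ.2 hσ hr hω.1 hω.2 hωh.le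
  obtain ⟨h₀, hh₀⟩ : ∃ h₀ : ℝ, smoothMaxEntropy ε'' (traceFst ρ) < (h₀ : EReal) := by
    obtain ⟨h, hh⟩ := exists_maxEntropy_le hρ.traceFst
    refine ⟨h + 1, lt_of_le_of_lt (iInf₂_le_of_le (traceFst ρ) ⟨hρ.traceFst, ?_⟩ hh)
      (EReal.coe_lt_coe_iff.mpr (lt_add_one h))⟩
    have h1 := purifiedDist_le_pureDist (CFC.sqrt (traceFst ρ)) (CFC.sqrt (traceFst ρ))
    rw [sqrt_mul_conjTranspose hρ.traceFst.1, pureDist_self (norm_vec_le_one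
      (by rw [sqrt_mul_conjTranspose hρ.traceFst.1]; exact hρ.traceFst.2))] at h1
    exact h1.trans hε''
  generalize smoothMaxEntropy ε'' (traceFst ρ) = B at *
  generalize smoothMinEntropy (ε + ε' + 2 * ε'') ρ = A at *
  induction B with
  | bot => exact absurd rfl hB
  | top => exact absurd hh₀ not_top_lt
  | coe β =>
    induction A with
    | bot => exact absurd (key h₀ hh₀) (not_le.mpr (EReal.bot_lt_coe _))
    | top => rw [EReal.top_add_coe, EReal.top_add_coe]; exact le_top
    | coe α =>
      rw [← EReal.coe_add, ← EReal.coe_add, EReal.coe_le_coe_iff]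
      refine le_of_forall_pos_le_add fun x hx => ?_
      have := EReal.coe_le_coe_iff.mp
        (key (β + x) (EReal.coe_lt_coe_iff.mpr (lt_add_of_pos_right β hx)))
      linarith

theorem smoothMaxEntropy_chain {ε ε' ε'' : ℝ} (hε : 0 < ε) (hε' : 0 ≤ ε') (hε'' : 0 ≤ ε'')
    {ρ : Matrix (a × b × c) (a × b × c) ℂ} (hρ : IsSubnormalized ρ)
    (hρε'' : ε'' < Real.sqrt ρ.trace.re) :
    smoothMinEntropy ε'' ρ + smoothMaxEntropy (ε + ε' + 2 * ε'') (traceFst ρ)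
        - ((2 * errorTerm ε : ℝ) : EReal) ≤ smoothMaxEntropy ε' (assocLeft ρ) := by
  by_cases hε1 : ε < 1
  swap
  · have : smoothMaxEntropy (ε + ε' + 2 * ε'') (traceFst ρ) = ⊥ := by
      refine le_bot_iff.mp (iInf₂_le_of_le 0 ⟨isSubnormalized_zero, ?_⟩ maxEntropy_zero.le)
      exact (purifiedDist_le_one _ _).trans (by linarith)
    rw [this, EReal.add_bot, EReal.bot_sub]
    exact bot_le
  have hne : Nonempty (a × b × c) := by
    by_contra hcon
    rw [not_nonempty_iff] at hcon
    have : ρ.trace.re = 0 := by simp [Matrix.trace]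
    rw [this, Real.sqrt_zero] at hρε''
    linarith
  have hbc : Nonempty (b × c) := hne.map Prod.snd
  refine le_iInf₂ fun τ hτ => EReal.le_of_forall_lt_iff_le.mp fun m hm => ?_
  have key : ∀ ω, IsSubnormalized ω ∧ purifiedDist ω ρ ≤ ε'' → ∀ σ, IsSubnormalized σ →
      ∀ k : ℝ, ω ≤ ((2 : ℝ) ^ (-k)) • ((1 : Matrix a a ℂ) ⊗ₖ σ) →
      smoothMaxEntropy (ε + ε' + 2 * ε'') (traceFst ρ) ≤
        ((m - k + 2 * errorTerm ε : ℝ) : EReal) := fun ω hω σ hσ k hk =>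
    smoothMaxEntropy_le_of_le hε hε1 hρ hτ.1 hτ.2 hm.le hω.1 hω.2 hσ hk
  generalize smoothMaxEntropy (ε + ε' + 2 * ε'') (traceFst ρ) = B at *
  induction B with
  | bot => rw [EReal.add_bot, EReal.bot_sub]; exact bot_le
  | top =>
    -- Any feasible `ω`, `σ`, `k` would bound the smooth max-entropy by a real number, so there are
    -- none.
    have : smoothMinEntropy ε'' ρ = ⊥ := by
      refine le_bot_iff.mp (iSup₂_le fun ω hω => iSup₂_le fun σ hσ => iSup₂_le fun k hk => ?_)
      exact absurd (key ω hω σ hσ k hk) (not_le.mpr (EReal.coe_lt_top _))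
    rw [this, EReal.bot_add, EReal.bot_sub]
    exact bot_le
  | coe β =>
    have : smoothMinEntropy ε'' ρ ≤ ((m - β + 2 * errorTerm ε : ℝ) : EReal) := by
      refine iSup₂_le fun ω hω => iSup₂_le fun σ hσ => iSup₂_le fun k hk => ?_
      have := EReal.coe_le_coe_iff.mp (key ω hω σ hσ k hk)
      rw [EReal.coe_le_coe_iff]
      linarith
    generalize smoothMinEntropy ε'' ρ = A at *
    induction A with
    | bot => rw [EReal.bot_add, EReal.bot_sub]; exact bot_le
    | top => exact absurd this (not_le.mpr (EReal.coe_lt_top _))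
    | coe α =>
      have := EReal.coe_le_coe_iff.mp this
      rw [← EReal.coe_add, ← EReal.coe_sub, EReal.coe_le_coe_iff]
      linarith

end Entropies

end

end SmoothEntropy

theorem mainTheorem2 {a b c : Type*} [Fintype a] [DecidableEq a] [Fintype b] [DecidableEq b]
    [Fintype c] [DecidableEq c]
    (ε ε' ε'' : ℝ) (hε : 0 < ε) (hε' : 0 ≤ ε') (hε'' : 0 ≤ ε'')
    (ρ : Matrix (a × b × c) (a × b × c) ℂ) (hρ : SmoothEntropy.IsSubnormalized ρ)
    (hρε'' : ε'' < Real.sqrt ρ.trace.re) :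
    SmoothEntropy.smoothMinEntropy ε' (SmoothEntropy.assocLeft ρ) ≤
        SmoothEntropy.smoothMinEntropy (ε + ε' + 2 * ε'') ρ
          + SmoothEntropy.smoothMaxEntropy ε'' (SmoothEntropy.traceFst ρ)
          + ((2 * SmoothEntropy.errorTerm ε : ℝ) : EReal) ∧
      SmoothEntropy.smoothMinEntropy ε'' ρ
          + SmoothEntropy.smoothMaxEntropy (ε + ε' + 2 * ε'') (SmoothEntropy.traceFst ρ)
          - ((2 * SmoothEntropy.errorTerm ε : ℝ) : EReal) ≤
        SmoothEntropy.smoothMaxEntropy ε' (SmoothEntropy.assocLeft ρ) :=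
  ⟨SmoothEntropy.smoothMinEntropy_chain hε hε' hε'' hρ hρε'',
    SmoothEntropy.smoothMaxEntropy_chain hε hε' hε'' hρ hρε''⟩
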